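/- Let $S\subset\mathbb R^3$ be a compact smooth ($C^\infty$) embedded surface without boundary, not necessarily connected, oriented by a continuous unit normal field $N$. Let $\mathbf z:S\to\mathbb R^3$ be an infinitesimal bending of $S$, i.e. a smooth vector field along $S$ (not necessarily tangent to it) such that, for every smooth regular local parametrization $\mathbf r=\mathbf r(u,v)$ of $S$, writing $\mathbf z=\mathbf z(\mathbf r(u,v))$, $$\mathbf r_u\cdot\mathbf z_u=0,\qquad \mathbf r_u\cdot\mathbf z_v+\mathbf r_v\cdot\mathbf z_u=0,\qquad \mathbf r_v\cdot\mathbf z_v=0 .$$ For $t\in\mathbb R$ put $S_t=\{\mathbf r+t\,\mathbf z(\mathbf r):\mathbf r\in S\}$, and for an oriented surface $\Sigma$ let $H(\Sigma)=\int_\Sigma\frac12(\kappa_1+\kappa_2)\,dS$ be its total mean curvature, where $\kappa_1,\kappa_2$ are the principal curvatures of $\Sigma$ with respect to its unit normal field and $dS$ is the area element. Then for all $t$ sufficiently close to $0$ the set $S_t$ is a smooth surface, oriented by the unit normal field induced from $N$ through the map $\mathbf r\mapsto\mathbf r+t\,\mathbf z(\mathbf r)$, and its mean curvature is integrable, so that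 $H(S_t)$ is defined; and the variation of the total mean curvature vanishes: the function $t\mapsto H(S_t)$ is differentiable at $t=0$ and $$\frac{d}{dt}\bigg|_{t=0}H(S_t)=0 .$$ -/

import Mathlib

open Set Filter Topology MeasureTheory
open scoped ContDiff

/-- Euclidean three-space `ℝ³`. -/
abbrev Space3 : Type := EuclideanSpace ℝ (Fin 3)

namespace Surf

noncomputable section

/-- The vector product of `ℝ³`. -/
def cross (a b : Space3) : Space3 :=
  WithLp.toLp 2 (crossProduct (WithLp.ofLp a) (WithLp.ofLp b))

/-- The partial derivative `r_u` of a vector function `r = r(u, v)`. -/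
def partialU (r : ℝ × ℝ → Space3) (w : ℝ × ℝ) : Space3 := fderiv ℝ r w (1, 0)

/-- The partial derivative `r_v` of a vector function `r = r(u, v)`. -/
def partialV (r : ℝ × ℝ → Space3) (w : ℝ × ℝ) : Space3 := fderiv ℝ r w (0, 1)

/-- `r : U → S` is a smooth regular local parametrization of the subset `S ⊂ ℝ³` by an open set
`U` of the `(u, v)`-plane: it is smooth, `r_u` and `r_v` are nowhere collinear, and `r` is a
homeomorphism of `U` onto a relatively open subset of `S`. -/
structure IsLocalParam (S : Set Space3) (U : Set (ℝ × ℝ)) (r : ℝ × ℝ → Space3) : Prop where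
  isOpen : IsOpen U
  contDiffOn : ContDiffOn ℝ ∞ r U
  linearIndependent : ∀ w ∈ U, LinearIndependent ℝ ![partialU r w, partialV r w]
  mapsTo : MapsTo r U S
  isOpenEmbedding : IsOpenEmbedding (mapsTo.restrict r U S)

/-- `S ⊂ ℝ³` is a smooth surface without boundary: every point of `S` lies in the image of a smooth
regular local parametrization by an open set of the plane. -/
def IsSmoothSurface (S : Set Space3) : Prop :=
  ∀ p ∈ S, ∃ U r, IsLocalParam S U r ∧ p ∈ r '' U

/-- `N` is an orientation of the surface `S`: a continuous field of unit normals along `S`.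
(Only the values of `N` on `S` matter.) -/
structure IsOrientation (S : Set Space3) (N : Space3 → Space3) : Prop where
  continuousOn : ContinuousOn N S
  norm_eq_one : ∀ p ∈ S, ‖N p‖ = 1
  normal : ∀ U r, IsLocalParam S U r → ∀ w ∈ U,
    inner ℝ (N (r w)) (partialU r w) = 0 ∧ inner ℝ (N (r w)) (partialV r w) = 0

/-- The smooth vector field `z` along `S` is an infinitesimal bending of `S`: in all local
parameters, `r_u · z_u = 0`, `r_u · z_v + r_v · z_u = 0`, `r_v · z_v = 0`.
(Only the values of `z` on `S` matter.) -/
structure IsInfinitesimalBending (S : Set Space3) (z : Space3 → Space3) : Prop where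
  smooth : ∀ U r, IsLocalParam S U r → ContDiffOn ℝ ∞ (z ∘ r) U
  bending : ∀ U r, IsLocalParam S U r → ∀ w ∈ U,
    inner ℝ (partialU r w) (partialU (z ∘ r) w) = 0 ∧
    inner ℝ (partialU r w) (partialV (z ∘ r) w) +
      inner ℝ (partialV r w) (partialU (z ∘ r) w) = 0 ∧
    inner ℝ (partialV r w) (partialV (z ∘ r) w) = 0

/-- The matrix `(E, F; F, G)` of the first fundamental form. -/
def firstForm (r : ℝ × ℝ → Space3) (w : ℝ × ℝ) : Matrix (Fin 2) (Fin 2) ℝ :=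
  !![inner ℝ (partialU r w) (partialU r w), inner ℝ (partialU r w) (partialV r w);
     inner ℝ (partialU r w) (partialV r w), inner ℝ (partialV r w) (partialV r w)]

/-- The matrix `(L, M; M, N)` of the second fundamental form with respect to the unit
normal `n`. -/
def secondForm (r : ℝ × ℝ → Space3) (n : Space3) (w : ℝ × ℝ) : Matrix (Fin 2) (Fin 2) ℝ :=
  !![inner ℝ (partialU (partialU r) w) n, inner ℝ (partialV (partialU r) w) n;
     inner ℝ (partialV (partialU r) w) n, inner ℝ (partialV (partialV r) w) n]

/-- The set of principal curvatures at `p` of the surface `S` oriented by `N`: the roots `κ` of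
`det (II - κ I) = 0`. They do not depend on the local parametrization, and there are one or two
of them at each point of `S`. -/
def principalCurvatures (S : Set Space3) (N : Space3 → Space3) (p : Space3) : Set ℝ :=
  {κ | ∃ U r w, IsLocalParam S U r ∧ w ∈ U ∧ r w = p ∧
    (secondForm r (N p) w - κ • firstForm r w).det = 0}

/-- The larger principal curvature. -/
def kappa1 (S : Set Space3) (N : Space3 → Space3) (p : Space3) : ℝ :=
  sSup (principalCurvatures S N p)

/-- The smaller principal curvature (equal to the larger one at an umbilic point, where the
equation has a double root). -/
def kappa2 (S : Set Space3) (N : Space3 → Space3) (p : Space3) : ℝ :=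
  sInf (principalCurvatures S N p)

/-- The mean curvature `(κ₁ + κ₂) / 2`. -/
def meanCurvature (S : Set Space3) (N : Space3 → Space3) (p : Space3) : ℝ :=
  (1 / 2) * (kappa1 S N p + kappa2 S N p)

/-- The measure `dS = |r_u × r_v| du dv` on the image of a local parametrization `r : U → S`. -/
def paramArea (U : Set (ℝ × ℝ)) (r : ℝ × ℝ → Space3) : Measure Space3 :=
  Measure.map r ((volume.restrict U).withDensity
    fun w => ENNReal.ofReal ‖cross (partialU r w) (partialV r w)‖)

/-- The surface area measure `dS` of `S`. The measures `|r_u × r_v| du dv` of any two local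
parametrizations agree on the intersection of their images; their supremum (the least measure
above all of them) is the measure obtained by gluing them together. -/
def areaMeasure (S : Set Space3) : Measure Space3 :=
  ⨆ (U : Set (ℝ × ℝ)) (r : ℝ × ℝ → Space3) (_ : IsLocalParam S U r), paramArea U r

/-- The total mean curvature `H(S) = ∫_S (κ₁ + κ₂) / 2 dS` of the surface `S` oriented
by `N`. -/
def totalMeanCurvature (S : Set Space3) (N : Space3 → Space3) : ℝ :=
  ∫ p, meanCurvature S N p ∂(areaMeasure S)

/-- The deformation `ψ(·, t) : r ↦ r + t z(r)`. -/
def deform (z : Space3 → Space3) (t : ℝ) (p : Space3) : Space3 := p + t • z p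

/-- `n` is the unit normal at `q` of the image `ψ(S)` that corresponds under `ψ` to the
orientation `N` of `S`: for a local parametrization `r` of `S` at a preimage of `q`, `n` is a unit
vector orthogonal to `(ψ ∘ r)_u` and `(ψ ∘ r)_v`, and the parametrizations `r` and `ψ ∘ r` are both
positive or both negative with respect to `N` and `n`. -/
def IsInducedNormal (S : Set Space3) (N ψ : Space3 → Space3) (q n : Space3) : Prop :=
  ∃ U r w, IsLocalParam S U r ∧ w ∈ U ∧ ψ (r w) = q ∧ ‖n‖ = 1 ∧
    inner ℝ n (partialU (ψ ∘ r) w) = 0 ∧ inner ℝ n (partialV (ψ ∘ r) w) = 0 ∧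
    0 < inner ℝ (N (r w)) (cross (partialU r w) (partialV r w)) *
      inner ℝ n (cross (partialU (ψ ∘ r) w) (partialV (ψ ∘ r) w))

open Classical in
/-- The orientation of `ψ(S)` induced through `ψ` by the orientation `N` of `S`. (When `ψ` maps `S`
injectively onto a surface and is immersive along `S`, the vector chosen here is unique.) -/
def inducedNormal (S : Set Space3) (N ψ : Space3 → Space3) (q : Space3) : Space3 :=
  if h : ∃ n, IsInducedNormal S N ψ q n then h.choose else 0

end

end Surf

/-!
The variation of the total mean curvature is the integral over `S` of an exact form, so it vanishes
by Stokes' theorem.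

In local parameters write `a = r_u`, `b = r_v`, `m = a × b`. An infinitesimal bending has a rotation
field `y`, determined by `z_u = y × a` and `z_v = y × b` (`cross_rotationVector`,
`IsInfinitesimalBending.exists_rotationField`). For either orientation the mean curvature times the
area density `|m|` is, up to a sign, a rational function of the first and second derivatives,
`(E N - 2 F M + G L) |m| / (2 |m| ^ 2)`. Along the deformation `r + t z` the coefficients `E, F, G`
are stationary at `t = 0`, and the derivative of the density is `(y_v · a - y_u · b) / 2`
(`hasDerivAt_meanDensity`). This is, up to a factor, the coefficient of the differential of the
globally defined form `y · dr`.

Stokes' theorem is proved with a partition of unity `ρ i` on a neighbourhood of `S` in `ℝ³`.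
Integration by parts in a chart turns the integral of `ρ i (y_v · a - y_u · b)` into that of
`(∇ ρ i × y) · m` (`IsInfinitesimalBending.integral_by_parts`), and these add up to zero because
`∑ i, ∇ ρ i = 0` on `S` (`IsInfinitesimalBending.sum_integral_eq_zero`).

Three facts connect this computation with the definitions. The inverse of a parametrization is
locally the restriction of a smooth map of `ℝ³` (`IsLocalParam.exists_local_inverse`); hence any two
parametrizations differ by a diffeomorphism, the principal curvatures can be computed in any chart
(`meanCurvature_eq`), and the area measure restricts to the area element of every chart
(`restrict_areaMeasure`). The deformed first fundamental form exceeds the original one by a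
nonnegative form and `z` is Lipschitz on `S`, so for small `t` the deformation is an injective
immersion (`eventually_isSurfaceEmbedding_deform`); the charts and the normal of `S` carry over to
its image. Finally the derivative is taken under the integral sign, over the compact supports of
the functions `ρ i` in the charts.
-/

namespace Surf

/-! ### Algebra of the inner and vector products of `ℝ³` -/

lemma inner_eq_sum (a b : Space3) : inner ℝ a b = a 0 * b 0 + a 1 * b 1 + a 2 * b 2 := by
  simp [PiLp.inner_apply, Fin.sum_univ_three, mul_comm]

lemma cross_apply_zero (a b : Space3) : cross a b 0 = a 1 * b 2 - a 2 * b 1 := by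
  simp [cross, crossProduct]

lemma cross_apply_one (a b : Space3) : cross a b 1 = a 2 * b 0 - a 0 * b 2 := by
  simp [cross, crossProduct]

lemma cross_apply_two (a b : Space3) : cross a b 2 = a 0 * b 1 - a 1 * b 0 := by
  simp [cross, crossProduct]

lemma space3_ext {a b : Space3} (h0 : a 0 = b 0) (h1 : a 1 = b 1) (h2 : a 2 = b 2) : a = b := by
  ext i; fin_cases i <;> assumption

lemma cross_add_smul (a b a' b' : Space3) (t : ℝ) :
    cross (a + t • a') (b + t • b') =
      cross a b + t • (cross a' b + cross a b') + t ^ 2 • cross a' b' := by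
  apply space3_ext <;>
    simp only [cross_apply_zero, cross_apply_one, cross_apply_two, PiLp.add_apply,
      PiLp.smul_apply, smul_eq_mul] <;> ring

lemma cross_linear_comb (a b : Space3) (p q r s : ℝ) :
    cross (p • a + q • b) (r • a + s • b) = (p * s - q * r) • cross a b := by
  apply space3_ext <;>
    simp only [cross_apply_zero, cross_apply_one, cross_apply_two, PiLp.add_apply,
      PiLp.smul_apply, smul_eq_mul] <;> ring

lemma inner_cross_left (a b : Space3) : inner ℝ a (cross a b) = 0 := by
  simp only [inner_eq_sum, cross_apply_zero, cross_apply_one, cross_apply_two]; ring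

lemma inner_cross_right (a b : Space3) : inner ℝ b (cross a b) = 0 := by
  simp only [inner_eq_sum, cross_apply_zero, cross_apply_one, cross_apply_two]; ring

/-- The Binet–Cauchy identity. -/
lemma inner_cross_cross (a b c d : Space3) :
    inner ℝ (cross a b) (cross c d) =
      inner ℝ a c * inner ℝ b d - inner ℝ a d * inner ℝ b c := by
  simp only [inner_eq_sum, cross_apply_zero, cross_apply_one, cross_apply_two]; ring

/-- Lagrange's identity. -/
lemma norm_cross_sq (a b : Space3) :
    ‖cross a b‖ ^ 2 = inner ℝ a a * inner ℝ b b - inner ℝ a b ^ 2 := by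
  rw [← real_inner_self_eq_norm_sq, inner_cross_cross, real_inner_comm a b]; ring

lemma cross_ne_zero {a b : Space3} (h : LinearIndependent ℝ ![a, b]) : cross a b ≠ 0 := by
  intro h0
  rw [LinearIndependent.pair_iff] at h
  have e := norm_cross_sq a b
  rw [h0, norm_zero] at e
  -- the equality case of the Cauchy–Schwarz inequality
  have hz : inner ℝ b b • a + (-inner ℝ a b) • b = 0 := by
    rw [← inner_self_eq_zero (𝕜 := ℝ)]
    simp only [inner_add_left, inner_add_right, inner_smul_left, inner_smul_right,
      RCLike.conj_to_real, real_inner_comm a b]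
    linear_combination -(inner ℝ b b) * e
  have hb := (h _ _ hz).1
  rw [inner_self_eq_zero] at hb
  have := h 0 1 (by simp [hb])
  simp at this

lemma inner_cross_self_pos {a b : Space3} (h : LinearIndependent ℝ ![a, b]) :
    0 < inner ℝ (cross a b) (cross a b) :=
  real_inner_self_pos.2 (cross_ne_zero h)

/-- The expansion of a vector in the basis `a, b, a × b`, paired against the dual basis. -/
lemma basis_expansion (a b x : Space3) :
    inner ℝ (cross a b) (cross a b) • x =
      (inner ℝ x a * inner ℝ b b - inner ℝ x b * inner ℝ a b) • a +
      (inner ℝ x b * inner ℝ a a - inner ℝ x a * inner ℝ a b) • b +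
      inner ℝ x (cross a b) • cross a b := by
  apply space3_ext <;>
    simp only [inner_eq_sum, cross_apply_zero, cross_apply_one, cross_apply_two, PiLp.add_apply,
      PiLp.smul_apply, smul_eq_mul] <;> ring

/-- A unit vector orthogonal to `a` and `b` is one of the two unit multiples of `a × b`. -/
lemma unit_normal_eq {a b n : Space3} (h : LinearIndependent ℝ ![a, b]) (hn : ‖n‖ = 1)
    (ha : inner ℝ n a = 0) (hb : inner ℝ n b = 0) :
    (0 < inner ℝ n (cross a b) ∧ n = ‖cross a b‖⁻¹ • cross a b) ∨
      (inner ℝ n (cross a b) < 0 ∧ n = -(‖cross a b‖⁻¹ • cross a b)) := by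
  have hm : 0 < ‖cross a b‖ := norm_pos_iff.2 (cross_ne_zero h)
  have e := basis_expansion a b n
  rw [ha, hb] at e
  simp only [zero_mul, sub_zero, zero_smul, zero_add, real_inner_self_eq_norm_sq] at e
  set c : ℝ := inner ℝ n (cross a b)
  have hc : c ^ 2 = ‖cross a b‖ ^ 2 := by
    have := congrArg (fun v => inner ℝ n v) e
    simp only [inner_smul_right, real_inner_self_eq_norm_sq, hn] at this
    linear_combination -this
  have hn' : n = (c / ‖cross a b‖ ^ 2) • cross a b := by
    rw [div_eq_inv_mul, mul_smul, ← e, smul_smul, inv_mul_cancel₀ (by positivity), one_smul]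
  rcases sq_eq_sq_iff_eq_or_eq_neg.1 hc with h1 | h1
  · refine Or.inl ⟨h1 ▸ hm, ?_⟩
    rw [hn', h1]; congr 1; field_simp
  · refine Or.inr ⟨h1 ▸ neg_lt_zero.2 hm, ?_⟩
    rw [hn', h1, ← neg_smul]; congr 1; field_simp

lemma isBoundedBilinearMap_cross :
    IsBoundedBilinearMap ℝ (fun p : Space3 × Space3 => cross p.1 p.2) := by
  refine ⟨fun x x' y => ?_, fun c x y => ?_, fun x y y' => ?_, fun c x y => ?_,
    1, one_pos, fun x y => ?_⟩
  iterate 4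
    apply space3_ext <;>
      simp only [cross_apply_zero, cross_apply_one, cross_apply_two, PiLp.add_apply,
        PiLp.smul_apply, smul_eq_mul] <;> ring
  refine (sq_le_sq₀ (norm_nonneg _) (by positivity)).1 ?_
  rw [norm_cross_sq, real_inner_self_eq_norm_sq, real_inner_self_eq_norm_sq]
  nlinarith [sq_nonneg (inner ℝ x y : ℝ)]

lemma contDiff_cross : ContDiff ℝ ∞ (fun p : Space3 × Space3 => cross p.1 p.2) :=
  isBoundedBilinearMap_cross.contDiff

/-! ### Pointwise identities of an infinitesimal bending -/

/-- The vector `y` with `a' = y × a` and `b' = y × b`, where `a, b` are independent and `a', b'` is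
an infinitesimal isometry of the plane they span. -/
noncomputable def rotationVector (a b a' b' : Space3) : Space3 :=
  (inner ℝ (cross a b) (cross a b))⁻¹ •
    (inner ℝ b' (cross a b) • a - inner ℝ a' (cross a b) • b + inner ℝ a' b • cross a b)

lemma cross_rotationVector {a b a' b' : Space3} (h : LinearIndependent ℝ ![a, b])
    (haa : inner ℝ a a' = 0) (hab : inner ℝ a b' + inner ℝ b a' = 0) (hbb : inner ℝ b b' = 0) :
    cross (rotationVector a b a' b') a = a' ∧ cross (rotationVector a b a' b') b = b' := by
  have hQ := inner_cross_self_pos h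
  have key (x : Space3) : cross (rotationVector a b a' b') x =
      (inner ℝ (cross a b) (cross a b))⁻¹ • (inner ℝ b' (cross a b) • cross a x -
        inner ℝ a' (cross a b) • cross b x + inner ℝ a' b • cross (cross a b) x) := by
    rw [rotationVector]
    apply space3_ext <;>
      simp only [cross_apply_zero, cross_apply_one, cross_apply_two, PiLp.add_apply,
        PiLp.smul_apply, PiLp.sub_apply, smul_eq_mul] <;> ring
  rw [key, key]
  constructor
  · rw [inv_smul_eq_iff₀ hQ.ne', basis_expansion a b a', real_inner_comm a a', haa]
    apply space3_ext <;>
      simp only [inner_eq_sum, cross_apply_zero, cross_apply_one, cross_apply_two, PiLp.add_apply,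
        PiLp.smul_apply, PiLp.sub_apply, smul_eq_mul] <;> ring
  · have hab' : inner ℝ b' a = -inner ℝ a' b := by
      rw [real_inner_comm a b', real_inner_comm b a']; linarith
    rw [inv_smul_eq_iff₀ hQ.ne', basis_expansion a b b', real_inner_comm b b', hbb, hab']
    apply space3_ext <;>
      simp only [inner_eq_sum, cross_apply_zero, cross_apply_one, cross_apply_two, PiLp.add_apply,
        PiLp.smul_apply, PiLp.sub_apply, smul_eq_mul] <;> ring

lemma eq_of_cross_eq {a b y y' : Space3} (h : LinearIndependent ℝ ![a, b])
    (ha : cross y a = cross y' a) (hb : cross y b = cross y' b) : y = y' := by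
  have h1 (x : Space3) (hx : cross y x = cross y' x) : cross (y - y') x = 0 := by
    have : cross (y - y') x = cross y x - cross y' x := by
      apply space3_ext <;>
        simp only [cross_apply_zero, cross_apply_one, cross_apply_two, PiLp.sub_apply] <;> ring
    rw [this, hx, sub_self]
  have ha' := h1 a ha
  have hb' := h1 b hb
  set d := y - y'
  -- the triple products of `d × a`, `d × b` recover the three components of `d`
  have hda : inner ℝ d a = 0 ∧ inner ℝ d b = 0 ∧ inner ℝ d (cross a b) = 0 := by
    have hQ := inner_cross_self_pos h
    have e1 := inner_cross_cross d a a b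
    have e2 := inner_cross_cross d b a b
    have e3 := inner_cross_cross a b a b
    rw [ha', inner_zero_left] at e1
    rw [hb', inner_zero_left] at e2
    rw [real_inner_comm a b] at e2 e3
    refine ⟨?_, ?_, ?_⟩
    · refine (mul_eq_zero.1 (?_ : inner ℝ (cross a b) (cross a b) * inner ℝ d a = 0)).resolve_left
        hQ.ne'
      rw [e3]; linear_combination inner ℝ a b * e1 - inner ℝ a a * e2
    · refine (mul_eq_zero.1 (?_ : inner ℝ (cross a b) (cross a b) * inner ℝ d b = 0)).resolve_left
        hQ.ne'
      rw [e3]; linear_combination inner ℝ b b * e1 - inner ℝ a b * e2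
    · have : inner ℝ d (cross a b) = inner ℝ (cross d a) b := by
        simp only [inner_eq_sum, cross_apply_zero, cross_apply_one, cross_apply_two]; ring
      rw [this, ha', inner_zero_left]
  have e := basis_expansion a b d
  rw [hda.1, hda.2.1, hda.2.2] at e
  simp only [zero_mul, sub_zero, zero_smul, add_zero] at e
  exact sub_eq_zero.1 ((smul_eq_zero.1 e).resolve_left (inner_cross_self_pos h).ne')

/-- The numerator `(E N - 2 F M + G L) |a × b|` of the mean curvature, as a function of the first
derivatives `a, b` and the second derivatives `c, d, e` of a parametrization. -/
noncomputable def meanNum (a b c d e : Space3) : ℝ :=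
  inner ℝ a a * inner ℝ e (cross a b) - 2 * inner ℝ a b * inner ℝ d (cross a b) +
    inner ℝ b b * inner ℝ c (cross a b)

/-- The mean curvature times the area density, for the normal in the direction `a × b`. -/
noncomputable def meanDensity (a b c d e : Space3) : ℝ :=
  meanNum a b c d e / (2 * inner ℝ (cross a b) (cross a b))

/-- The integrand of the variation of the total mean curvature. Here `y` is the rotation vector of
the bending and `yu`, `yv` are its derivatives; the derivatives of the bending field are expressed
through them, and `hmix` is the equality of its mixed second derivatives. -/
lemma hasDerivAt_meanDensity {a b c d e y yu yv : Space3} (h : LinearIndependent ℝ ![a, b])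
    (hmix : cross yu b = cross yv a) :
    HasDerivAt (fun t : ℝ => meanDensity (a + t • cross y a) (b + t • cross y b)
      (c + t • (cross yu a + cross y c)) (d + t • (cross yv a + cross y d))
      (e + t • (cross yv b + cross y e)))
      ((inner ℝ yv a - inner ℝ yu b) / 2) 0 := by
  have hQ := inner_cross_self_pos h
  have hlin (x x' : Space3) : HasDerivAt (fun t : ℝ => x + t • x') x' 0 := by
    simpa using ((hasDerivAt_id (0 : ℝ)).smul_const x').const_add x
  have hcr : HasDerivAt (fun t : ℝ => cross (a + t • cross y a) (b + t • cross y b))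
      (cross (cross y a) b + cross a (cross y b)) 0 := by
    simp only [cross_add_smul]
    have := (hlin (cross a b) (cross (cross y a) b + cross a (cross y b))).add
      (((hasDerivAt_id (0 : ℝ)).pow 2).smul_const (cross (cross y a) (cross y b)))
    refine (this.congr_deriv (by simp)).congr_of_eventuallyEq (Eventually.of_forall fun t => ?_)
    simp
  have hnum := ((((hlin a (cross y a)).inner ℝ (hlin a (cross y a))).mul
    ((hlin e (cross yv b + cross y e)).inner ℝ hcr)).sub
    ((((hlin a (cross y a)).inner ℝ (hlin b (cross y b))).const_mul 2).mul
    ((hlin d (cross yv a + cross y d)).inner ℝ hcr))).add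
    (((hlin b (cross y b)).inner ℝ (hlin b (cross y b))).mul
    ((hlin c (cross yu a + cross y c)).inner ℝ hcr))
  have hden := (hcr.inner ℝ hcr).const_mul 2
  have hdiv := hnum.div hden (by simpa using (cross_ne_zero h))
  have hrot : cross (cross y a) b + cross a (cross y b) = cross y (cross a b) := by
    apply space3_ext <;>
      simp only [cross_apply_zero, cross_apply_one, cross_apply_two, PiLp.add_apply] <;> ring
  have hskew (x x' : Space3) : inner ℝ x (cross y x') = -inner ℝ (cross y x) x' := by
    simp only [inner_eq_sum, cross_apply_zero, cross_apply_one, cross_apply_two]; ring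
  have hself (x : Space3) : inner ℝ (cross y x) x = 0 := by
    rw [real_inner_comm, inner_eq_sum, cross_apply_zero, cross_apply_one, cross_apply_two]; ring
  have hyv : inner ℝ (cross yv a) (cross a b) = inner ℝ (cross yu b) (cross a b) := by rw [hmix]
  refine hdiv.congr_deriv ?_
  simp only [zero_smul, add_zero, Pi.mul_apply, Pi.sub_apply, Pi.add_apply, hrot, hskew, hself,
    inner_add_left, neg_zero, mul_zero, sub_zero, zero_mul]
  rw [div_eq_iff (by positivity)]
  rw [inner_cross_cross, inner_cross_cross] at hyv
  simp only [inner_cross_cross, real_inner_comm a b] at hyv ⊢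
  linear_combination (-inner ℝ a b *
    (2 * (inner ℝ a a * inner ℝ b b - inner ℝ a b * inner ℝ a b))) * hyv

section

/-! ### Changes of parameters -/

variable {S : Set Space3} {U U' : Set (ℝ × ℝ)} {r r' : ℝ × ℝ → Space3}

lemma fderiv_apply_eq (r : ℝ × ℝ → Space3) (w v : ℝ × ℝ) :
    fderiv ℝ r w v = v.1 • partialU r w + v.2 • partialV r w := by
  have hv : v = v.1 • ((1 : ℝ), (0 : ℝ)) + v.2 • ((0 : ℝ), (1 : ℝ)) := by ext <;> simp
  conv_lhs => rw [hv]
  rw [map_add, map_smul, map_smul]; rfl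

lemma IsLocalParam.contDiffAt (h : IsLocalParam S U r) {w : ℝ × ℝ} (hw : w ∈ U) :
    ContDiffAt ℝ ∞ r w :=
  h.contDiffOn.contDiffAt (h.isOpen.mem_nhds hw)

lemma IsLocalParam.injOn (h : IsLocalParam S U r) : InjOn r U := by
  intro x hx y hy hxy
  have := h.isOpenEmbedding.injective (a₁ := ⟨x, hx⟩) (a₂ := ⟨y, hy⟩) (Subtype.ext hxy)
  exact congrArg Subtype.val this

/-- Restricted to `S`, the inverse of a parametrization is smooth: it is the composition of a linear
projection of `ℝ³` onto the parameter plane with a local inverse supplied by the inverse function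
theorem. -/
lemma IsLocalParam.exists_local_inverse (h : IsLocalParam S U r) {w : ℝ × ℝ} (hw : w ∈ U) :
    ∃ g : Space3 → ℝ × ℝ, ContDiffAt ℝ ∞ g (r w) ∧ g (r w) = w ∧
      ∀ᶠ p in 𝓝[S] (r w), g p ∈ U ∧ r (g p) = p := by
  have hker : ((fderiv ℝ r w : ℝ × ℝ →L[ℝ] Space3) : ℝ × ℝ →ₗ[ℝ] Space3).ker = ⊥ := by
    rw [LinearMap.ker_eq_bot']
    intro v hv
    have hv' : v.1 • partialU r w + v.2 • partialV r w = 0 := by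
      rw [← fderiv_apply_eq]; exact hv
    have := LinearIndependent.pair_iff.1 (h.linearIndependent w hw) _ _ hv'
    exact Prod.ext this.1 this.2
  obtain ⟨L₀, hL₀⟩ := LinearMap.exists_leftInverse_of_injective _ hker
  let L : Space3 →L[ℝ] ℝ × ℝ := LinearMap.toContinuousLinearMap L₀
  have hL : L.comp (fderiv ℝ r w) =
      (ContinuousLinearEquiv.refl ℝ (ℝ × ℝ) : ℝ × ℝ →L[ℝ] ℝ × ℝ) := by
    ext1 <;> ext1 <;> exact LinearMap.congr_fun hL₀ _
  have hr := h.contDiffAt hw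
  have hf : ContDiffAt ℝ ∞ (L ∘ r) w := L.contDiff.contDiffAt.comp w hr
  have hf' : HasFDerivAt (L ∘ r)
      (ContinuousLinearEquiv.refl ℝ (ℝ × ℝ) : ℝ × ℝ →L[ℝ] ℝ × ℝ) w := by
    rw [← hL]
    exact L.hasFDerivAt.comp w (hr.differentiableAt (by simp)).hasFDerivAt
  have hinv : ∀ᶠ x in 𝓝 w, hf.localInverse hf' (by simp) (L (r x)) = x :=
    (hf.hasStrictFDerivAt' hf' (by simp)).eventually_left_inverse
  refine ⟨hf.localInverse hf' (by simp) ∘ L, ?_, hinv.self_of_nhds, ?_⟩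
  · exact (hf.to_localInverse hf' (by simp)).comp (r w) L.contDiff.contDiffAt
  · have hmap := h.isOpenEmbedding.map_nhds_eq ⟨w, hw⟩
    have hsub : ∀ᶠ x : U in 𝓝 (⟨w, hw⟩ : U),
        hf.localInverse hf' (by simp) (L (r x)) = x :=
      (continuous_subtype_val.tendsto (⟨w, hw⟩ : U)).eventually hinv
    rw [nhdsWithin_eq_map_subtype_coe (h.mapsTo hw), eventually_map]
    change ∀ᶠ p : S in 𝓝 (h.mapsTo.restrict r U S ⟨w, hw⟩), _
    rw [← hmap, eventually_map]
    filter_upwards [hsub] with x hx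
    have hx' : hf.localInverse hf' (by simp) (L (h.mapsTo.restrict r U S x)) = x := hx
    simp only [Function.comp_apply]
    rw [hx']
    exact ⟨x.2, rfl⟩

lemma IsLocalParam.exists_transition (h : IsLocalParam S U r) (h' : IsLocalParam S U' r')
    {w w' : ℝ × ℝ} (hw : w ∈ U) (hw' : w' ∈ U') (e : r w = r' w') :
    ∃ φ : ℝ × ℝ → ℝ × ℝ, ContDiffAt ℝ ∞ φ w ∧ φ w = w' ∧
      ∀ᶠ x in 𝓝 w, φ x ∈ U' ∧ r x = r' (φ x) := by
  obtain ⟨g, hg, hgw, hgS⟩ := h'.exists_local_inverse hw'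
  rw [← e] at hg hgw hgS
  refine ⟨g ∘ r, hg.comp w (h.contDiffAt hw), hgw, ?_⟩
  have ht : Tendsto r (𝓝 w) (𝓝[S] (r w)) :=
    tendsto_nhdsWithin_iff.2 ⟨(h.contDiffAt hw).continuousAt,
      mem_of_superset (h.isOpen.mem_nhds hw) fun x hx => h.mapsTo hx⟩
  filter_upwards [ht.eventually hgS] with x hx using ⟨hx.1, hx.2.symm⟩

lemma partial_comp {f X : ℝ × ℝ → Space3} {φ : ℝ × ℝ → ℝ × ℝ} {w : ℝ × ℝ}
    (hX : DifferentiableAt ℝ X (φ w)) (hφ : DifferentiableAt ℝ φ w) (hf : f =ᶠ[𝓝 w] X ∘ φ) :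
    partialU f w = (fderiv ℝ φ w (1, 0)).1 • partialU X (φ w) +
        (fderiv ℝ φ w (1, 0)).2 • partialV X (φ w) ∧
    partialV f w = (fderiv ℝ φ w (0, 1)).1 • partialU X (φ w) +
        (fderiv ℝ φ w (0, 1)).2 • partialV X (φ w) := by
  have : fderiv ℝ f w = (fderiv ℝ X (φ w)).comp (fderiv ℝ φ w) := by
    rw [hf.fderiv_eq]; exact fderiv_comp w hX hφ
  constructor
  · rw [partialU, this, ContinuousLinearMap.comp_apply, fderiv_apply_eq]
  · rw [partialV, this, ContinuousLinearMap.comp_apply, fderiv_apply_eq]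

/-- The Jacobian determinant of a map of the plane. -/
noncomputable def jacobian (φ : ℝ × ℝ → ℝ × ℝ) (w : ℝ × ℝ) : ℝ :=
  (fderiv ℝ φ w (1, 0)).1 * (fderiv ℝ φ w (0, 1)).2 -
    (fderiv ℝ φ w (1, 0)).2 * (fderiv ℝ φ w (0, 1)).1

lemma cross_partial_comp {f X : ℝ × ℝ → Space3} {φ : ℝ × ℝ → ℝ × ℝ} {w : ℝ × ℝ}
    (hX : DifferentiableAt ℝ X (φ w)) (hφ : DifferentiableAt ℝ φ w) (hf : f =ᶠ[𝓝 w] X ∘ φ) :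
    cross (partialU f w) (partialV f w) =
      jacobian φ w • cross (partialU X (φ w)) (partialV X (φ w)) := by
  obtain ⟨h1, h2⟩ := partial_comp hX hφ hf
  rw [h1, h2, cross_linear_comb]; rfl

lemma det_fderiv_eq_jacobian (φ : ℝ × ℝ → ℝ × ℝ) (w : ℝ × ℝ) :
    (fderiv ℝ φ w).det = jacobian φ w := by
  rw [ContinuousLinearMap.det, ← LinearMap.det_toMatrix (Module.Basis.finTwoProd ℝ),
    Matrix.det_fin_two]
  simp [LinearMap.toMatrix_apply, jacobian, mul_comm]

/-! ### The fundamental forms and the mean curvature in local parameters -/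

lemma contDiffAt_fderiv {r : ℝ × ℝ → Space3} {w : ℝ × ℝ} (h : ContDiffAt ℝ ∞ r w) :
    ContDiffAt ℝ ∞ (fderiv ℝ r) w := h.fderiv_right (by simp)

lemma contDiffAt_partialU {r : ℝ × ℝ → Space3} {w : ℝ × ℝ} (h : ContDiffAt ℝ ∞ r w) :
    ContDiffAt ℝ ∞ (partialU r) w := (contDiffAt_fderiv h).clm_apply contDiffAt_const

lemma contDiffAt_partialV {r : ℝ × ℝ → Space3} {w : ℝ × ℝ} (h : ContDiffAt ℝ ∞ r w) :
    ContDiffAt ℝ ∞ (partialV r) w := (contDiffAt_fderiv h).clm_apply contDiffAt_const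

lemma fderiv_fderiv_apply {r : ℝ × ℝ → Space3} {w : ℝ × ℝ} (h : ContDiffAt ℝ ∞ r w)
    (v v' : ℝ × ℝ) :
    fderiv ℝ (fun x => fderiv ℝ r x v) w v' = fderiv ℝ (fderiv ℝ r) w v' v := by
  have := ((contDiffAt_fderiv h).differentiableAt (by simp)).hasFDerivAt.clm_apply
    (hasFDerivAt_const v w)
  rw [this.fderiv]; simp

lemma partialU_partialV_comm {r : ℝ × ℝ → Space3} {w : ℝ × ℝ} (h : ContDiffAt ℝ ∞ r w) :
    partialU (partialV r) w = partialV (partialU r) w := by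
  change fderiv ℝ (fun x => fderiv ℝ r x (0, 1)) w (1, 0) =
    fderiv ℝ (fun x => fderiv ℝ r x (1, 0)) w (0, 1)
  rw [fderiv_fderiv_apply h, fderiv_fderiv_apply h]
  refine h.isSymmSndFDerivAt ?_ _ _
  rw [minSmoothness_of_isRCLikeNormedField]
  exact WithTop.coe_le_coe.2 le_top

lemma fderiv_fderiv_apply_eq {r : ℝ × ℝ → Space3} {w : ℝ × ℝ} (h : ContDiffAt ℝ ∞ r w)
    (v v' : ℝ × ℝ) :
    fderiv ℝ (fderiv ℝ r) w v v' = (v.1 * v'.1) • partialU (partialU r) w +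
      (v.1 * v'.2 + v.2 * v'.1) • partialV (partialU r) w +
      (v.2 * v'.2) • partialV (partialV r) w := by
  rw [← fderiv_fderiv_apply h]
  have e : (fun x => fderiv ℝ r x v') = fun x => v'.1 • partialU r x + v'.2 • partialV r x :=
    funext fun x => fderiv_apply_eq r x v'
  have hu := (contDiffAt_partialU h).differentiableAt (by simp)
  have hv := (contDiffAt_partialV h).differentiableAt (by simp)
  have hd := (hu.hasFDerivAt.const_smul v'.1).add (hv.hasFDerivAt.const_smul v'.2)
  rw [e, show fderiv ℝ (fun x => v'.1 • partialU r x + v'.2 • partialV r x) w = _ from hd.fderiv]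
  simp only [_root_.add_apply, _root_.smul_apply, fderiv_apply_eq,
    partialU_partialV_comm h]
  module

/-- Under a change of parameters the second derivatives transform, up to tangent vectors, like a
bilinear form. -/
lemma inner_snd_deriv_comp {f X : ℝ × ℝ → Space3} {φ : ℝ × ℝ → ℝ × ℝ} {w : ℝ × ℝ} {n : Space3}
    (hX : ContDiffAt ℝ ∞ X (φ w)) (hφ : ContDiffAt ℝ ∞ φ w) (hf : f =ᶠ[𝓝 w] X ∘ φ)
    (hu : inner ℝ n (partialU X (φ w)) = 0) (hv : inner ℝ n (partialV X (φ w)) = 0)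
    (i j : ℝ × ℝ) :
    inner ℝ (fderiv ℝ (fun x => fderiv ℝ f x i) w j) n =
      inner ℝ (fderiv ℝ (fderiv ℝ X) (φ w) (fderiv ℝ φ w j) (fderiv ℝ φ w i)) n := by
  have h1 : ∀ᶠ x in 𝓝 w, DifferentiableAt ℝ φ x :=
    ((hφ.of_le (by simp : (1 : WithTop ℕ∞) ≤ ∞)).eventually (by simp)).mono
      fun x hx => hx.differentiableAt (by simp)
  have h2 : ∀ᶠ x in 𝓝 w, DifferentiableAt ℝ X (φ x) :=
    hφ.continuousAt.eventually (((hX.of_le (by simp : (1 : WithTop ℕ∞) ≤ ∞)).eventually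
      (by simp)).mono fun x hx => hx.differentiableAt (by simp))
  have e : (fun x => fderiv ℝ f x i) =ᶠ[𝓝 w]
      fun x => fderiv ℝ X (φ x) (fderiv ℝ φ x i) := by
    filter_upwards [h1, h2, hf.eventuallyEq_nhds] with x hx1 hx2 hx3
    rw [hx3.fderiv_eq, fderiv_comp x hx2 hx1]; rfl
  have hφ' : ContDiffAt ℝ ∞ (fderiv ℝ φ) w := hφ.fderiv_right (by simp)
  have hd1 : HasFDerivAt (fun x => fderiv ℝ X (φ x)) _ w :=
    (((contDiffAt_fderiv hX).differentiableAt (by simp)).hasFDerivAt).comp w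
      (hφ.differentiableAt (by simp)).hasFDerivAt
  have hd2 : HasFDerivAt (fun x => fderiv ℝ φ x i) _ w :=
    (hφ'.differentiableAt (by simp)).hasFDerivAt.clm_apply (hasFDerivAt_const i w)
  rw [e.fderiv_eq, (hd1.clm_apply hd2).fderiv]
  rw [_root_.add_apply, ContinuousLinearMap.comp_apply, inner_add_left, fderiv_apply_eq X,
    inner_add_left, inner_smul_left, inner_smul_left, real_inner_comm n, real_inner_comm n, hu, hv]
  simp

/-- The matrix pencil of the two fundamental forms changes by congruence under a change of
parameters. -/
lemma det_pencil_comp {f X : ℝ × ℝ → Space3} {φ : ℝ × ℝ → ℝ × ℝ} {w : ℝ × ℝ} {n : Space3}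
    (hX : ContDiffAt ℝ ∞ X (φ w)) (hφ : ContDiffAt ℝ ∞ φ w) (hf : f =ᶠ[𝓝 w] X ∘ φ)
    (hu : inner ℝ n (partialU X (φ w)) = 0) (hv : inner ℝ n (partialV X (φ w)) = 0) (κ : ℝ) :
    (secondForm f n w - κ • firstForm f w).det =
      jacobian φ w ^ 2 * (secondForm X n (φ w) - κ • firstForm X (φ w)).det := by
  have key := inner_snd_deriv_comp hX hφ hf hu hv
  obtain ⟨e1, e2⟩ := partial_comp (hX.differentiableAt (by simp)) (hφ.differentiableAt (by simp)) hf
  have huu : inner ℝ (partialU (partialU f) w) n = _ := key (1, 0) (1, 0)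
  have huv : inner ℝ (partialV (partialU f) w) n = _ := key (1, 0) (0, 1)
  have hvv : inner ℝ (partialV (partialV f) w) n = _ := key (0, 1) (0, 1)
  simp only [fderiv_fderiv_apply_eq hX, inner_add_left, inner_smul_left, RCLike.conj_to_real]
    at huu huv hvv
  rw [Matrix.det_fin_two, Matrix.det_fin_two]
  simp only [secondForm, firstForm, Matrix.sub_apply, Matrix.smul_apply, Matrix.of_apply,
    Matrix.cons_val', Matrix.cons_val_zero, Matrix.cons_val_one, Matrix.cons_val_fin_one,
    smul_eq_mul, huu, huv, hvv, e1, e2, inner_add_left, inner_add_right, inner_smul_left,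
    inner_smul_right, RCLike.conj_to_real, jacobian,
    real_inner_comm (partialU X (φ w)) (partialV X (φ w))]
  ring

lemma jacobian_ne_zero {f X : ℝ × ℝ → Space3} {φ : ℝ × ℝ → ℝ × ℝ} {w : ℝ × ℝ}
    (hX : DifferentiableAt ℝ X (φ w)) (hφ : DifferentiableAt ℝ φ w) (hf : f =ᶠ[𝓝 w] X ∘ φ)
    (hl : LinearIndependent ℝ ![partialU f w, partialV f w]) : jacobian φ w ≠ 0 := by
  intro h0
  apply cross_ne_zero hl
  rw [cross_partial_comp hX hφ hf, h0, zero_smul]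

lemma principalCurvatures_eq (h : IsLocalParam S U r) {N : Space3 → Space3} {w : ℝ × ℝ}
    (hw : w ∈ U) (hu : inner ℝ (N (r w)) (partialU r w) = 0)
    (hv : inner ℝ (N (r w)) (partialV r w) = 0) :
    principalCurvatures S N (r w) =
      {κ | (secondForm r (N (r w)) w - κ • firstForm r w).det = 0} := by
  ext κ
  constructor
  · rintro ⟨U', r', w', h', hw', e, hdet⟩
    obtain ⟨φ, hφ, rfl, hφS⟩ := h'.exists_transition h hw' hw e
    have hf : r' =ᶠ[𝓝 w'] r ∘ φ := hφS.mono fun x hx => hx.2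
    have hr := h.contDiffAt hw
    rw [det_pencil_comp hr hφ hf hu hv] at hdet
    exact (mul_eq_zero.1 hdet).resolve_left (pow_ne_zero 2 (jacobian_ne_zero
      (hr.differentiableAt (by simp)) (hφ.differentiableAt (by simp)) hf
      (h'.linearIndependent w' hw')))
  · exact fun hκ => ⟨U, r, w, h, hw, rfl, hκ⟩

/-- Vieta's formula for the sum of the roots of a quadratic equation with real roots. -/
lemma sSup_add_sInf_roots {A B C : ℝ} (hA : 0 < A) (hD : 0 ≤ B ^ 2 - 4 * A * C) :
    sSup {κ : ℝ | A * κ ^ 2 - B * κ + C = 0} + sInf {κ : ℝ | A * κ ^ 2 - B * κ + C = 0} =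
      B / A := by
  have hs := Real.sq_sqrt hD
  set s := √(B ^ 2 - 4 * A * C)
  have : {κ : ℝ | A * κ ^ 2 - B * κ + C = 0} = {(B + s) / (2 * A), (B - s) / (2 * A)} := by
    ext κ
    simp only [mem_ofPred_eq, mem_insert_iff, mem_singleton_iff]
    have e : A * κ ^ 2 - B * κ + C = A * ((κ - (B + s) / (2 * A)) * (κ - (B - s) / (2 * A))) := by
      field_simp
      linear_combination hs
    rw [e, mul_eq_zero, mul_eq_zero, sub_eq_zero, sub_eq_zero]
    exact or_iff_right hA.ne'
  rw [this, csSup_pair, csInf_pair, max_add_min]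
  field_simp; ring

lemma meanCurvature_eq (h : IsLocalParam S U r) {N : Space3 → Space3} {w : ℝ × ℝ}
    (hw : w ∈ U) (hu : inner ℝ (N (r w)) (partialU r w) = 0)
    (hv : inner ℝ (N (r w)) (partialV r w) = 0) :
    meanCurvature S N (r w) =
      (inner ℝ (partialU r w) (partialU r w) * inner ℝ (partialV (partialV r) w) (N (r w)) -
        2 * inner ℝ (partialU r w) (partialV r w) * inner ℝ (partialV (partialU r) w) (N (r w)) +
        inner ℝ (partialV r w) (partialV r w) * inner ℝ (partialU (partialU r) w) (N (r w))) /
      (2 * inner ℝ (cross (partialU r w) (partialV r w))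
        (cross (partialU r w) (partialV r w))) := by
  have hQ := inner_cross_self_pos (h.linearIndependent w hw)
  have hE : 0 < inner ℝ (partialU r w) (partialU r w) := real_inner_self_pos.2 <| by
    have := (h.linearIndependent w hw).ne_zero 0
    simpa using this
  rw [meanCurvature, kappa1, kappa2, principalCurvatures_eq h hw hu hv]
  rw [inner_cross_cross, real_inner_comm (partialU r w) (partialV r w)] at hQ ⊢
  simp only [Matrix.det_fin_two, secondForm, firstForm, Matrix.sub_apply, Matrix.smul_apply,
    Matrix.of_apply, Matrix.cons_val', Matrix.cons_val_zero, Matrix.cons_val_one,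
    Matrix.cons_val_fin_one, smul_eq_mul]
  set E := inner ℝ (partialU r w) (partialU r w)
  set F := inner ℝ (partialU r w) (partialV r w)
  set G := inner ℝ (partialV r w) (partialV r w)
  set a := inner ℝ (partialU (partialU r) w) (N (r w))
  set b := inner ℝ (partialV (partialU r) w) (N (r w))
  set c := inner ℝ (partialV (partialV r) w) (N (r w))
  have hset : {κ : ℝ | (a - κ * E) * (c - κ * G) - (b - κ * F) * (b - κ * F) = 0} =
      {κ : ℝ | (E * G - F * F) * κ ^ 2 - (E * c - 2 * F * b + G * a) * κ +
        (a * c - b ^ 2) = 0} := by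
    ext κ
    simp only [mem_ofPred_eq]
    constructor <;> intro hκ <;> linear_combination hκ
  -- the pencil is definite, hence has real roots
  have hD : 0 ≤ (E * c - 2 * F * b + G * a) ^ 2 - 4 * (E * G - F * F) * (a * c - b ^ 2) := by
    have e : E ^ 2 * ((E * c - 2 * F * b + G * a) ^ 2 - 4 * (E * G - F * F) * (a * c - b ^ 2)) =
        4 * (E * G - F * F) * (E * b - F * a) ^ 2 +
          (E * (E * c - G * a) - 2 * F * (E * b - F * a)) ^ 2 := by ring
    have hE2 : 0 < E ^ 2 := by positivity
    refine nonneg_of_mul_nonneg_right (a := E ^ 2) ?_ hE2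
    rw [e]
    have := mul_nonneg (mul_nonneg zero_le_four hQ.le) (sq_nonneg (E * b - F * a))
    positivity
  rw [hset, sSup_add_sInf_roots hQ hD]
  field_simp

end

section

/-! ### The area measure of a compact surface -/

variable {S : Set Space3} {U U' : Set (ℝ × ℝ)} {r r' : ℝ × ℝ → Space3}

/-- A compact set locally parametrized by charts with a property `P` is covered by finitely
many of them. -/
lemma exists_finite_cover (hSc : IsCompact S) {P : Set (ℝ × ℝ) → (ℝ × ℝ → Space3) → Prop}
    (hP : ∀ p ∈ S, ∃ U r, IsLocalParam S U r ∧ P U r ∧ p ∈ r '' U) :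
    ∃ (n : ℕ) (U : Fin n → Set (ℝ × ℝ)) (r : Fin n → ℝ × ℝ → Space3),
      (∀ i, IsLocalParam S (U i) (r i)) ∧ (∀ i, P (U i) (r i)) ∧ S ⊆ ⋃ i, r i '' U i := by
  choose! U r hUr hPUr hmem using hP
  have hnhds : ∀ p ∈ S, r p '' U p ∈ 𝓝[S] p := by
    intro p hp
    obtain ⟨w, hw, e⟩ := hmem p hp
    obtain ⟨g, -, -, hg⟩ := (hUr p hp).exists_local_inverse hw
    rw [e] at hg
    filter_upwards [hg] with q hq using ⟨g q, hq.1, hq.2⟩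
  obtain ⟨t, htS, ht⟩ := hSc.elim_nhdsWithin_subcover (fun p => r p '' U p) hnhds
  let e := t.equivFin
  refine ⟨t.card, fun i => U (e.symm i), fun i => r (e.symm i),
    fun i => hUr _ (htS _ (e.symm i).2), fun i => hPUr _ (htS _ (e.symm i).2), ?_⟩
  intro p hp
  obtain ⟨q, hq, hpq⟩ := mem_iUnion₂.1 (ht hp)
  exact mem_iUnion.2 ⟨e ⟨q, hq⟩, by simpa using hpq⟩

lemma IsLocalParam.continuousOn (h : IsLocalParam S U r) : ContinuousOn r U :=
  h.contDiffOn.continuousOn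

lemma IsLocalParam.continuousOn_cross (h : IsLocalParam S U r) :
    ContinuousOn (fun w => cross (partialU r w) (partialV r w)) U := by
  intro w hw
  refine ContinuousAt.continuousWithinAt ?_
  have hr := h.contDiffAt hw
  exact (contDiff_cross.continuous.continuousAt).comp
    ((contDiffAt_partialU hr).continuousAt.prodMk (contDiffAt_partialV hr).continuousAt)

lemma IsLocalParam.measurableEmbedding (h : IsLocalParam S U r) :
    MeasurableEmbedding (U.domRestrict r) :=
  h.continuousOn.measurableEmbedding h.isOpen.measurableSet h.injOn

lemma IsLocalParam.measurableSet_image (h : IsLocalParam S U r) : MeasurableSet (r '' U) :=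
  h.isOpen.measurableSet.image_of_continuousOn_injOn h.continuousOn h.injOn

lemma IsLocalParam.measurableSet_inter_preimage (h : IsLocalParam S U r) {B : Set Space3}
    (hB : MeasurableSet B) : MeasurableSet (U ∩ r ⁻¹' B) := by
  have : U ∩ r ⁻¹' B = Subtype.val '' (U.domRestrict r ⁻¹' B) := by
    ext w; constructor
    · exact fun hw => ⟨⟨w, hw.1⟩, hw.2, rfl⟩
    · rintro ⟨x, hx, rfl⟩; exact ⟨x.2, hx⟩
  rw [this]
  exact h.isOpen.measurableSet.subtype_image (h.measurableEmbedding.measurable hB)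

lemma IsLocalParam.aemeasurable (h : IsLocalParam S U r) :
    AEMeasurable r ((volume.restrict U).withDensity
      fun w => ENNReal.ofReal ‖cross (partialU r w) (partialV r w)‖) :=
  (h.continuousOn.aemeasurable h.isOpen.measurableSet).mono_ac
    (withDensity_absolutelyContinuous _ _)

lemma IsLocalParam.paramArea_apply (h : IsLocalParam S U r) {B : Set Space3}
    (hB : MeasurableSet B) : paramArea U r B =
      ∫⁻ w in U ∩ r ⁻¹' B, ENNReal.ofReal ‖cross (partialU r w) (partialV r w)‖ := by
  rw [paramArea, Measure.map_apply_of_aemeasurable h.aemeasurable hB, withDensity_apply',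
    Measure.restrict_restrict' h.isOpen.measurableSet, inter_comm]

lemma IsLocalParam.paramArea_inter_image (h : IsLocalParam S U r) {B : Set Space3}
    (hB : MeasurableSet B) : paramArea U r (B ∩ r '' U) = paramArea U r B := by
  rw [h.paramArea_apply hB, h.paramArea_apply (hB.inter h.measurableSet_image)]
  congr 2
  ext w
  exact ⟨fun hw => ⟨hw.1, hw.2.1⟩, fun hw => ⟨hw.1, hw.2, mem_image_of_mem r hw.1⟩⟩

/-- The area elements of two parametrizations agree where both are defined, by the change of
variables formula. -/
lemma IsLocalParam.paramArea_eq (h : IsLocalParam S U r) (h' : IsLocalParam S U' r')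
    {B : Set Space3} (hB : MeasurableSet B) (hBU : B ⊆ r '' U) (hBU' : B ⊆ r' '' U') :
    paramArea U r B = paramArea U' r' B := by
  classical
  rw [h.paramArea_apply hB, h'.paramArea_apply hB]
  set φ : ℝ × ℝ → ℝ × ℝ := fun w => Function.invFunOn r' U' (r w) with hφdef
  have hφ {w : ℝ × ℝ} (hw : w ∈ U ∩ r ⁻¹' B) : φ w ∈ U' ∧ r' (φ w) = r w :=
    Function.invFunOn_pos (hBU' hw.2)
  have himage : φ '' (U ∩ r ⁻¹' B) = U' ∩ r' ⁻¹' B := by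
    ext w'; constructor
    · rintro ⟨w, hw, rfl⟩
      exact ⟨(hφ hw).1, by rw [mem_preimage, (hφ hw).2]; exact hw.2⟩
    · rintro ⟨hw', hwB⟩
      obtain ⟨w, hw, e⟩ := hBU hwB
      have hwm : w ∈ U ∩ r ⁻¹' B := ⟨hw, by rw [mem_preimage, e]; exact hwB⟩
      exact ⟨w, hwm, h'.injOn (hφ hwm).1 hw' ((hφ hwm).2.trans e)⟩
  have hinj : InjOn φ (U ∩ r ⁻¹' B) := by
    intro x hx y hy hxy
    refine h.injOn hx.1 hy.1 ?_
    rw [← (hφ hx).2, ← (hφ hy).2, hxy]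
  -- near each point, `φ` coincides on its domain with a smooth change of parameters
  have hloc : ∀ w ∈ U ∩ r ⁻¹' B, ∃ φ' : ℝ × ℝ →L[ℝ] ℝ × ℝ,
      HasFDerivWithinAt φ φ' (U ∩ r ⁻¹' B) w ∧ ‖cross (partialU r w) (partialV r w)‖ =
        |φ'.det| * ‖cross (partialU r' (φ w)) (partialV r' (φ w))‖ := by
    intro w hw
    obtain ⟨χ, hχ, hχw, hχe⟩ := h.exists_transition h' hw.1 (hφ hw).1 (hφ hw).2.symm
    have hχd := hχ.differentiableAt (by simp)
    refine ⟨fderiv ℝ χ w, ?_, ?_⟩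
    · refine hχd.hasFDerivAt.hasFDerivWithinAt.congr_of_eventuallyEq ?_ hχw.symm
      filter_upwards [nhdsWithin_le_nhds hχe, self_mem_nhdsWithin] with x hx hxm
      exact h'.injOn (hφ hxm).1 hx.1 ((hφ hxm).2.trans hx.2)
    · have hX : DifferentiableAt ℝ r' (χ w) := by
        rw [hχw]; exact (h'.contDiffAt (hφ hw).1).differentiableAt (by simp)
      rw [cross_partial_comp hX hχd (hχe.mono fun x hx => hx.2), norm_smul,
        det_fderiv_eq_jacobian, Real.norm_eq_abs, hχw]
  choose! φ' hφ' hnorm using hloc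
  rw [← himage, lintegral_image_eq_lintegral_abs_det_fderiv_mul volume
    (h.measurableSet_inter_preimage hB) hφ' hinj]
  refine setLIntegral_congr_fun (h.measurableSet_inter_preimage hB) fun w hw => ?_
  simp only [hnorm w hw]
  rw [ENNReal.ofReal_mul (abs_nonneg _)]

lemma paramArea_le_areaMeasure (h : IsLocalParam S U r) : paramArea U r ≤ areaMeasure S :=
  le_iSup₂_of_le U r (le_iSup_of_le h le_rfl)

/-- A finite atlas cut into disjoint pieces dominates the area measure. -/
lemma areaMeasure_le_sum {n : ℕ} {U : Fin n → Set (ℝ × ℝ)} {r : Fin n → ℝ × ℝ → Space3}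
    (h : ∀ i, IsLocalParam S (U i) (r i)) (hcov : S ⊆ ⋃ i, r i '' U i) :
    areaMeasure S ≤ Measure.sum fun i =>
      (paramArea (U i) (r i)).restrict (disjointed (fun i => r i '' U i) i) := by
  have hD (i : Fin n) : MeasurableSet (disjointed (fun i => r i '' U i) i) :=
    disjointedRec (fun _ _ ht => ht.diff (h _).measurableSet_image) (h i).measurableSet_image
  refine iSup_le fun V => iSup_le fun ρ => iSup_le fun hρ => Measure.le_iff.2 fun B hB => ?_
  rw [Measure.sum_apply _ hB, ← hρ.paramArea_inter_image hB]
  have hsub : B ∩ ρ '' V ⊆ ⋃ i, B ∩ ρ '' V ∩ disjointed (fun i => r i '' U i) i := by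
    rw [← inter_iUnion, iUnion_disjointed]
    exact subset_inter subset_rfl
      (inter_subset_right.trans ((image_subset_iff.2 hρ.mapsTo).trans hcov))
  refine (measure_mono hsub).trans ((measure_iUnion_le _).trans (ENNReal.tsum_le_tsum fun i => ?_))
  rw [Measure.restrict_apply hB,
    hρ.paramArea_eq (h i) ((hB.inter hρ.measurableSet_image).inter (hD i))
    (inter_subset_left.trans inter_subset_right)
    (inter_subset_right.trans (disjointed_subset _ i))]
  exact measure_mono (inter_subset_inter_left _ inter_subset_left)

/-- On the image of a parametrization, the area measure is the area element `|r_u × r_v| du dv`. -/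
lemma restrict_areaMeasure (hS : IsSmoothSurface S) (hSc : IsCompact S)
    (hr : IsLocalParam S U r) : (areaMeasure S).restrict (r '' U) = paramArea U r := by
  obtain ⟨n, V, ρ, h, -, hcov⟩ := exists_finite_cover (P := fun _ _ => True) hSc
    fun p hp => (hS p hp).imp fun U hU => hU.imp fun r hr => ⟨hr.1, trivial, hr.2⟩
  have hD (i : Fin n) : MeasurableSet (disjointed (fun i => ρ i '' V i) i) :=
    disjointedRec (fun _ _ ht => ht.diff (h _).measurableSet_image) (h i).measurableSet_image
  refine le_antisymm (Measure.le_iff.2 fun B hB => ?_) (Measure.le_iff.2 fun B hB => ?_)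
  · have hBr := hB.inter hr.measurableSet_image
    rw [Measure.restrict_apply hB]
    refine (areaMeasure_le_sum h hcov _).trans ?_
    rw [Measure.sum_apply _ hBr]
    have e (i : Fin n) : (paramArea (V i) (ρ i)).restrict (disjointed (fun i => ρ i '' V i) i)
        (B ∩ r '' U) = paramArea U r (B ∩ r '' U ∩ disjointed (fun i => ρ i '' V i) i) := by
      rw [Measure.restrict_apply hBr]
      exact (h i).paramArea_eq hr (hBr.inter (hD i))
        (inter_subset_right.trans (disjointed_subset _ i))
        (inter_subset_left.trans inter_subset_right)
    simp only [e]
    rw [← measure_iUnion]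
    · exact measure_mono (iUnion_subset fun i => inter_subset_left.trans inter_subset_left)
    · exact fun i j hij => (disjoint_disjointed _ hij).mono inter_subset_right inter_subset_right
    · exact fun i => hBr.inter (hD i)
  · rw [Measure.restrict_apply hB, ← hr.paramArea_inter_image hB]
    exact paramArea_le_areaMeasure hr _

lemma areaMeasure_compl (hS : IsSmoothSurface S) (hSc : IsCompact S) : areaMeasure S Sᶜ = 0 := by
  obtain ⟨n, V, ρ, h, -, hcov⟩ := exists_finite_cover (P := fun _ _ => True) hSc
    fun p hp => (hS p hp).imp fun U hU => hU.imp fun r hr => ⟨hr.1, trivial, hr.2⟩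
  refine le_antisymm ((areaMeasure_le_sum h hcov _).trans ?_) zero_le
  rw [Measure.sum_apply _ hSc.measurableSet.compl, nonpos_iff_eq_zero, ENNReal.tsum_eq_zero]
  intro i
  rw [Measure.restrict_apply hSc.measurableSet.compl]
  convert measure_empty (μ := paramArea (V i) (ρ i))
  refine eq_empty_of_forall_notMem fun p hp => hp.1 ?_
  obtain ⟨w, hw, rfl⟩ := disjointed_subset _ i hp.2
  exact (h i).mapsTo hw

/-! ### Surface integrals in local parameters -/

lemma IsLocalParam.paramArea_eq_map (h : IsLocalParam S U r) :
    paramArea U r = Measure.map (U.domRestrict r) (Measure.comap Subtype.val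
      ((volume.restrict U).withDensity
        fun w => ENNReal.ofReal ‖cross (partialU r w) (partialV r w)‖)) := by
  have hU := h.isOpen.measurableSet
  have e : Measure.map Subtype.val (Measure.comap (Subtype.val : U → ℝ × ℝ)
      ((volume.restrict U).withDensity
        fun w => ENNReal.ofReal ‖cross (partialU r w) (partialV r w)‖)) =
      (volume.restrict U).withDensity
        fun w => ENNReal.ofReal ‖cross (partialU r w) (partialV r w)‖ := by
    rw [map_comap_subtype_coe hU, restrict_withDensity hU, Measure.restrict_restrict hU, inter_self]
  have hr := h.aemeasurable
  rw [paramArea]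
  conv_lhs => rw [← e]
  rw [← e] at hr
  exact AEMeasurable.map_map_of_aemeasurable hr measurable_subtype_coe.aemeasurable

lemma IsLocalParam.aemeasurable_density (h : IsLocalParam S U r) :
    AEMeasurable (fun w => ENNReal.ofReal ‖cross (partialU r w) (partialV r w)‖)
      (volume.restrict U) :=
  (h.continuousOn_cross.norm.aemeasurable h.isOpen.measurableSet).ennreal_ofReal

lemma IsLocalParam.integral_paramArea (h : IsLocalParam S U r) (k : Space3 → ℝ) :
    ∫ p, k p ∂(paramArea U r) = ∫ w in U, ‖cross (partialU r w) (partialV r w)‖ * k (r w) := by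
  have hU := h.isOpen.measurableSet
  rw [h.paramArea_eq_map, h.measurableEmbedding.integral_map]
  refine (integral_subtype_comap hU (fun w => k (r w))).trans ?_
  rw [restrict_withDensity hU, Measure.restrict_restrict hU, inter_self,
    integral_withDensity_eq_integral_toReal_smul₀ h.aemeasurable_density
      (Eventually.of_forall fun _ => ENNReal.ofReal_lt_top)]
  simp

lemma IsLocalParam.integrable_paramArea (h : IsLocalParam S U r) {k : Space3 → ℝ}
    (hk : IntegrableOn (fun w => ‖cross (partialU r w) (partialV r w)‖ * k (r w)) U) :
    Integrable k (paramArea U r) := by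
  have hU := h.isOpen.measurableSet
  rw [h.paramArea_eq_map, h.measurableEmbedding.integrable_map_iff]
  refine (integrableOn_iff_comap_subtypeVal (f := fun w => k (r w)) hU).1 ?_
  rw [IntegrableOn, restrict_withDensity hU, Measure.restrict_restrict hU, inter_self,
    integrable_withDensity_iff_integrable_smul₀' h.aemeasurable_density
      (Eventually.of_forall fun _ => ENNReal.ofReal_lt_top)]
  simpa [IntegrableOn] using hk

lemma integrable_areaMeasure_of_support (hS : IsSmoothSurface S) (hSc : IsCompact S)
    (h : IsLocalParam S U r) {k : Space3 → ℝ} (hsupp : ∀ p ∉ r '' U, k p = 0)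
    (hk : IntegrableOn (fun w => ‖cross (partialU r w) (partialV r w)‖ * k (r w)) U) :
    Integrable k (areaMeasure S) := by
  refine IntegrableOn.integrable_of_forall_notMem_eq_zero (s := r '' U) ?_ hsupp
  rw [IntegrableOn, restrict_areaMeasure hS hSc h]
  exact h.integrable_paramArea hk

lemma integral_areaMeasure_of_support (hS : IsSmoothSurface S) (hSc : IsCompact S)
    (h : IsLocalParam S U r) {k : Space3 → ℝ} (hsupp : ∀ p ∉ r '' U, k p = 0) :
    ∫ p, k p ∂(areaMeasure S) =
      ∫ w in U, ‖cross (partialU r w) (partialV r w)‖ * k (r w) := by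
  rw [← setIntegral_eq_integral_of_forall_compl_eq_zero hsupp, restrict_areaMeasure hS hSc h,
    h.integral_paramArea]

/-- A surface integral computed with a finite atlas and weights `l i` supported in its charts,
of sum `1` on the surface. -/
lemma integral_areaMeasure_eq_sum (hS : IsSmoothSurface S) (hSc : IsCompact S) {n : ℕ}
    {U : Fin n → Set (ℝ × ℝ)} {r : Fin n → ℝ × ℝ → Space3} {l : Fin n → Space3 → ℝ}
    (h : ∀ i, IsLocalParam S (U i) (r i)) (hsum : ∀ p ∈ S, ∑ i, l i p = 1)
    (hsupp : ∀ i, ∀ p ∉ r i '' U i, l i p = 0) {k : Space3 → ℝ}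
    (hk : ∀ i, IntegrableOn (fun w => ‖cross (partialU (r i) w) (partialV (r i) w)‖ *
      (l i (r i w) * k (r i w))) (U i)) :
    Integrable k (areaMeasure S) ∧ ∫ p, k p ∂(areaMeasure S) =
      ∑ i, ∫ w in U i, ‖cross (partialU (r i) w) (partialV (r i) w)‖ *
        (l i (r i w) * k (r i w)) := by
  have hint (i : Fin n) : Integrable (fun p => l i p * k p) (areaMeasure S) :=
    integrable_areaMeasure_of_support hS hSc (h i) (fun p hp => by simp [hsupp i p hp]) (hk i)
  have hae : (fun p => ∑ i, l i p * k p) =ᵐ[areaMeasure S] k := by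
    have : ∀ᵐ p ∂(areaMeasure S), p ∈ S := areaMeasure_compl hS hSc
    filter_upwards [this] with p hp
    rw [← Finset.sum_mul, hsum p hp, one_mul]
  refine ⟨(integrable_finsetSum _ fun i _ => hint i).congr hae, ?_⟩
  rw [← integral_congr_ae hae, integral_finsetSum _ fun i _ => hint i]
  exact Finset.sum_congr rfl fun i _ =>
    integral_areaMeasure_of_support hS hSc (h i) fun p hp => by simp [hsupp i p hp]

end

section

/-! ### Fields along a surface -/

variable {S : Set Space3} {U V : Set (ℝ × ℝ)} {r : ℝ × ℝ → Space3} {N ψ z : Space3 → Space3}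

/-- A field along `S` that is smooth in local parameters extends smoothly to a neighbourhood of each
point of `S`. -/
lemma exists_local_extension (hS : IsSmoothSurface S)
    (hz : ∀ U r, IsLocalParam S U r → ContDiffOn ℝ ∞ (z ∘ r) U) {p : Space3} (hp : p ∈ S) :
    ∃ Z : Space3 → Space3, ContDiffAt ℝ ∞ Z p ∧ z =ᶠ[𝓝[S] p] Z := by
  obtain ⟨U, r, h, w, hw, rfl⟩ := hS p hp
  obtain ⟨g, hg, hgw, hgS⟩ := h.exists_local_inverse hw
  refine ⟨(z ∘ r) ∘ g, ContDiffAt.comp _ ?_ hg, hgS.mono fun q hq => ?_⟩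
  · rw [hgw]; exact (hz U r h).contDiffAt (h.isOpen.mem_nhds hw)
  · simp only [Function.comp_apply, hq.2]

lemma continuousOn_of_smooth (hS : IsSmoothSurface S)
    (hz : ∀ U r, IsLocalParam S U r → ContDiffOn ℝ ∞ (z ∘ r) U) : ContinuousOn z S := by
  intro p hp
  obtain ⟨Z, hZ, e⟩ := exists_local_extension hS hz hp
  exact hZ.continuousAt.continuousWithinAt.congr_of_eventuallyEq e (e.self_of_nhdsWithin hp)

lemma exists_lipschitzOnWith_of_smooth (hS : IsSmoothSurface S) (hSc : IsCompact S)
    (hz : ∀ U r, IsLocalParam S U r → ContDiffOn ℝ ∞ (z ∘ r) U) : ∃ K, LipschitzOnWith K z S := by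
  refine LocallyLipschitzOn.exists_lipschitzOnWith_of_compact hSc fun p hp => ?_
  obtain ⟨Z, hZ, e⟩ := exists_local_extension hS hz hp
  obtain ⟨K, t, ht, hK⟩ := (hZ.of_le (by simp : (1 : WithTop ℕ∞) ≤ ∞)).exists_lipschitzOnWith
  refine ⟨K, t ∩ {q | z q = Z q}, inter_mem (nhdsWithin_le_nhds ht) e, ?_⟩
  intro x hx y hy
  rw [hx.2, hy.2]
  exact hK hx.1 hy.1

/-! ### Images of a surface under embeddings -/

/-- `ψ` embeds the surface `S`: it is smooth, immersive and injective along `S`. -/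
structure IsSurfaceEmbedding (S : Set Space3) (ψ : Space3 → Space3) : Prop where
  smooth : ∀ U r, IsLocalParam S U r → ContDiffOn ℝ ∞ (ψ ∘ r) U
  immersive : ∀ U r, IsLocalParam S U r → ∀ w ∈ U,
    LinearIndependent ℝ ![partialU (ψ ∘ r) w, partialV (ψ ∘ r) w]
  injOn : InjOn ψ S

lemma IsSurfaceEmbedding.isLocalParam (hψ : IsSurfaceEmbedding S ψ) (hS : IsSmoothSurface S)
    (hSc : IsCompact S) (h : IsLocalParam S U r) : IsLocalParam (ψ '' S) U (ψ ∘ r) := by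
  refine ⟨h.isOpen, hψ.smooth U r h, hψ.immersive U r h,
    fun w hw => mem_image_of_mem ψ (h.mapsTo hw), ?_⟩
  have : CompactSpace S := isCompact_iff_compactSpace.1 hSc
  let e : S ≃ ψ '' S := hψ.injOn.bijOn_image.equiv ψ
  have he : Continuous e :=
    ((continuousOn_of_smooth hS hψ.smooth).domRestrict).subtype_mk _
  exact (he.homeoOfEquivCompactToT2 (f := e)).isOpenEmbedding.comp h.isOpenEmbedding

lemma IsSurfaceEmbedding.isSmoothSurface (hψ : IsSurfaceEmbedding S ψ) (hS : IsSmoothSurface S)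
    (hSc : IsCompact S) : IsSmoothSurface (ψ '' S) := by
  rintro _ ⟨p, hp, rfl⟩
  obtain ⟨U, r, h, w, hw, rfl⟩ := hS p hp
  exact ⟨U, ψ ∘ r, hψ.isLocalParam hS hSc h, w, hw, rfl⟩

lemma IsSurfaceEmbedding.isCompact (hψ : IsSurfaceEmbedding S ψ) (hS : IsSmoothSurface S)
    (hSc : IsCompact S) : IsCompact (ψ '' S) :=
  hSc.image_of_continuousOn (continuousOn_of_smooth hS hψ.smooth)

lemma IsLocalParam.mono (h : IsLocalParam S U r) (hV : IsOpen V) (hVU : V ⊆ U) :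
    IsLocalParam S V r := by
  refine ⟨hV, h.contDiffOn.mono hVU, fun w hw => h.linearIndependent w (hVU hw),
    h.mapsTo.mono_left hVU, ?_⟩
  have hi : IsOpenEmbedding (Set.inclusion hVU) :=
    IsOpenEmbedding.inclusion hVU (hV.preimage continuous_subtype_val)
  exact h.isOpenEmbedding.comp hi

/-- On the whole parametrization `r : U → S` the normal field `N` is `ε (r_u × r_v) / |r_u × r_v|`
with one sign `ε = ± 1`. -/
def HasNormalSign (N : Space3 → Space3) (ε : ℝ) (U : Set (ℝ × ℝ)) (r : ℝ × ℝ → Space3) : Prop :=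
  ε ^ 2 = 1 ∧ ∀ w ∈ U, N (r w) =
    (ε * ‖cross (partialU r w) (partialV r w)‖⁻¹) • cross (partialU r w) (partialV r w)

lemma exists_hasNormalSign (hS : IsSmoothSurface S) (hN : IsOrientation S N) {p : Space3}
    (hp : p ∈ S) : ∃ U r, IsLocalParam S U r ∧ (∃ ε, HasNormalSign N ε U r) ∧ p ∈ r '' U := by
  obtain ⟨U, r, h, w, hw, rfl⟩ := hS p hp
  set f : ℝ × ℝ → ℝ := fun x => inner ℝ (N (r x)) (cross (partialU r x) (partialV r x)) with hf
  have hfc : ContinuousOn f U :=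
    (hN.continuousOn.comp h.continuousOn h.mapsTo).inner h.continuousOn_cross
  have hu (x) (hx : x ∈ U) := unit_normal_eq (h.linearIndependent x hx)
    (hN.norm_eq_one _ (h.mapsTo hx)) (hN.normal U r h x hx).1 (hN.normal U r h x hx).2
  rcases hu w hw with ⟨hpos, -⟩ | ⟨hneg, -⟩
  · refine ⟨U ∩ f ⁻¹' Ioi 0, r, h.mono (hfc.isOpen_inter_preimage h.isOpen isOpen_Ioi)
      inter_subset_left, ⟨1, by norm_num, fun x hx => ?_⟩, w, ⟨hw, hpos⟩, rfl⟩
    rcases hu x hx.1 with h1 | h1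
    · rw [one_mul]; exact h1.2
    · exact absurd h1.1 (not_lt.2 (le_of_lt hx.2))
  · refine ⟨U ∩ f ⁻¹' Iio 0, r, h.mono (hfc.isOpen_inter_preimage h.isOpen isOpen_Iio)
      inter_subset_left, ⟨-1, by norm_num, fun x hx => ?_⟩, w, ⟨hw, hneg⟩, rfl⟩
    rcases hu x hx.1 with h1 | h1
    · exact absurd h1.1 (not_lt.2 (le_of_lt hx.2))
    · rw [neg_one_mul, neg_smul]; exact h1.2

/-- The normal of `ψ(S)` induced through `ψ` is given by the same sign as that of `S`. -/
lemma IsSurfaceEmbedding.inducedNormal_eq (hψ : IsSurfaceEmbedding S ψ) (h : IsLocalParam S U r)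
    {ε : ℝ} (hε : HasNormalSign N ε U r) :
    HasNormalSign (inducedNormal S N ψ) ε U (ψ ∘ r) := by
  refine ⟨hε.1, fun w hw => ?_⟩
  have hm := cross_ne_zero (h.linearIndependent w hw)
  have hM := cross_ne_zero (hψ.immersive U r h w hw)
  have hNm : inner ℝ (N (r w)) (cross (partialU r w) (partialV r w)) =
      ε * ‖cross (partialU r w) (partialV r w)‖ := by
    have := norm_pos_iff.2 hm
    rw [hε.2 w hw, inner_smul_left, real_inner_self_eq_norm_sq, RCLike.conj_to_real]
    field_simp
  set m := cross (partialU r w) (partialV r w) with hmdef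
  set M := cross (partialU (ψ ∘ r) w) (partialV (ψ ∘ r) w) with hMdef
  have hm' := norm_pos_iff.2 hm
  have hM' := norm_pos_iff.2 hM
  have hex : IsInducedNormal S N ψ ((ψ ∘ r) w) ((ε * ‖M‖⁻¹) • M) := by
    refine ⟨U, r, w, h, hw, rfl, ?_, ?_, ?_, ?_⟩
    · have : |ε| = 1 := by rw [← sq_eq_sq₀ (abs_nonneg _) zero_le_one, sq_abs, hε.1, one_pow]
      rw [norm_smul, norm_mul, norm_inv, norm_norm, Real.norm_eq_abs, this, one_mul,
        inv_mul_cancel₀ hM'.ne']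
    · rw [inner_smul_left, real_inner_comm, inner_cross_left, mul_zero]
    · rw [inner_smul_left, real_inner_comm, inner_cross_right, mul_zero]
    · rw [← hmdef, ← hMdef, hNm, inner_smul_left, real_inner_self_eq_norm_sq, RCLike.conj_to_real]
      have : ε * ‖m‖ * (ε * ‖M‖⁻¹ * ‖M‖ ^ 2) = ‖m‖ * ‖M‖ := by
        field_simp; rw [hε.1]
      rw [this]; positivity
  have hall : ∀ n, IsInducedNormal S N ψ ((ψ ∘ r) w) n → n = (ε * ‖M‖⁻¹) • M := by
    rintro n ⟨U', r', w', h', hw', e, hn, hn1, hn2, hpos⟩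
    have e' : r' w' = r w := hψ.injOn (h'.mapsTo hw') (h.mapsTo hw) e
    obtain ⟨χ, hχ, rfl, hχe⟩ := h.exists_transition h' hw hw' e'.symm
    have hχd := hχ.differentiableAt (by simp)
    have h1 : r =ᶠ[𝓝 w] r' ∘ χ := hχe.mono fun x hx => hx.2
    have h2 : ψ ∘ r =ᶠ[𝓝 w] (ψ ∘ r') ∘ χ := h1.mono fun x hx => congrArg ψ hx
    have hr' := (h'.contDiffAt hw').differentiableAt (by simp)
    have hψr' := ((hψ.smooth U' r' h').contDiffAt (h'.isOpen.mem_nhds hw')).differentiableAt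
      (by simp)
    have c1 : m = _ := cross_partial_comp hr' hχd h1
    have c2 : M = _ := cross_partial_comp hψr' hχd h2
    have hJ := jacobian_ne_zero hr' hχd h1 (h.linearIndependent w hw)
    obtain ⟨p1, p2⟩ := partial_comp hψr' hχd h2
    have hprod : 0 < inner ℝ (N (r w)) m * inner ℝ n M := by
      rw [c1, c2, inner_smul_right, inner_smul_right, ← e']
      have := mul_pos (sq_pos_of_ne_zero hJ) hpos
      linarith
    rw [hNm] at hprod
    have hcase := unit_normal_eq (hψ.immersive U r h w hw) hn
      (by rw [p1, inner_add_right, inner_smul_right, inner_smul_right, hn1, hn2]; simp)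
      (by rw [p2, inner_add_right, inner_smul_right, inner_smul_right, hn1, hn2]; simp)
    rcases sq_eq_sq_iff_eq_or_eq_neg.1 (hε.1.trans (one_pow 2).symm) with h1 | h1
    · rcases hcase with ⟨-, hc⟩ | ⟨hc, -⟩
      · rw [h1, one_mul]; exact hc
      · rw [h1, one_mul] at hprod
        exact absurd hprod (not_lt.2 (mul_nonpos_of_nonneg_of_nonpos hm'.le hc.le))
    · rcases hcase with ⟨hc, -⟩ | ⟨-, hc⟩
      · rw [h1, neg_one_mul, neg_mul] at hprod
        exact absurd hprod (not_lt.2 (neg_nonpos.2 (mul_nonneg hm'.le hc.le)))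
      · rw [h1, neg_one_mul, neg_smul]; exact hc
  unfold inducedNormal
  rw [dif_pos ⟨_, hex⟩]
  exact hall _ (Exists.choose_spec (⟨_, hex⟩ : ∃ n, IsInducedNormal S N ψ ((ψ ∘ r) w) n))

lemma IsSurfaceEmbedding.isOrientation (hψ : IsSurfaceEmbedding S ψ) (hS : IsSmoothSurface S)
    (hSc : IsCompact S) (hN : IsOrientation S N) :
    IsOrientation (ψ '' S) (inducedNormal S N ψ) := by
  refine ⟨?_, ?_, ?_⟩
  · rintro _ ⟨p, hp, rfl⟩
    obtain ⟨U, r, h, ⟨ε, hε⟩, w, hw, rfl⟩ := exists_hasNormalSign hS hN hp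
    have hR := hψ.isLocalParam hS hSc h
    have hn := (hψ.inducedNormal_eq h hε).2
    obtain ⟨g, hg, hgw, hgS⟩ := hR.exists_local_inverse hw
    have hgw' : g (ψ (r w)) = w := hgw
    set k : ℝ × ℝ → Space3 := fun w => (ε * ‖cross (partialU (ψ ∘ r) w) (partialV (ψ ∘ r) w)‖⁻¹) •
      cross (partialU (ψ ∘ r) w) (partialV (ψ ∘ r) w) with hk
    have hkc : ContinuousAt k w := by
      have hc := hR.continuousOn_cross.continuousAt (h.isOpen.mem_nhds hw)
      exact (continuousAt_const.mul (hc.norm.inv₀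
        (norm_ne_zero_iff.2 (cross_ne_zero (hR.linearIndependent w hw))))).smul hc
    have hkg : ContinuousAt (k ∘ g) (ψ (r w)) :=
      ContinuousAt.comp (by rw [hgw']; exact hkc) hg.continuousAt
    refine hkg.continuousWithinAt.congr_of_eventuallyEq (hgS.mono fun q hq => ?_) ?_
    · have := hn (g q) hq.1
      rwa [hq.2] at this
    · rw [Function.comp_apply, hgw']; exact hn w hw
  · rintro _ ⟨p, hp, rfl⟩
    obtain ⟨U, r, h, ⟨ε, hε⟩, w, hw, rfl⟩ := exists_hasNormalSign hS hN hp
    have hn := (hψ.inducedNormal_eq h hε).2 w hw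
    have hM := norm_pos_iff.2 (cross_ne_zero (hψ.immersive U r h w hw))
    have : |ε| = 1 := by rw [← sq_eq_sq₀ (abs_nonneg _) zero_le_one, sq_abs, hε.1, one_pow]
    rw [Function.comp_apply] at hn
    rw [hn, norm_smul, norm_mul, norm_inv, norm_norm, Real.norm_eq_abs, this, one_mul,
      inv_mul_cancel₀ hM.ne']
  · intro U' r' h' w' hw'
    obtain ⟨p, hp, e⟩ := h'.mapsTo hw'
    obtain ⟨U, r, h, ⟨ε, hε⟩, w, hw, rfl⟩ := exists_hasNormalSign hS hN hp
    have hR := hψ.isLocalParam hS hSc h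
    obtain ⟨χ, hχ, rfl, hχe⟩ := h'.exists_transition hR hw' hw e.symm
    obtain ⟨p1, p2⟩ := partial_comp ((hR.contDiffAt hw).differentiableAt (by simp))
      (hχ.differentiableAt (by simp)) (hχe.mono fun x hx => hx.2)
    have hn := (hψ.inducedNormal_eq h hε).2 _ hw
    rw [← e, show ψ (r (χ w')) = (ψ ∘ r) (χ w') from rfl, hn, p1, p2]
    simp only [inner_smul_left, inner_add_right, inner_smul_right,
      real_inner_comm _ (cross _ _), inner_cross_left, inner_cross_right, mul_zero, add_zero,
      and_self]

/-! ### The deformation of a surface by an infinitesimal bending -/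

lemma deform_comp (z : Space3 → Space3) (t : ℝ) (r : ℝ × ℝ → Space3) :
    deform z t ∘ r = r + t • (z ∘ r) := rfl

lemma partial_deform {w : ℝ × ℝ} (hr : DifferentiableAt ℝ r w)
    (hz : DifferentiableAt ℝ (z ∘ r) w) (t : ℝ) :
    partialU (deform z t ∘ r) w = partialU r w + t • partialU (z ∘ r) w ∧
      partialV (deform z t ∘ r) w = partialV r w + t • partialV (z ∘ r) w := by
  have : fderiv ℝ (deform z t ∘ r) w = fderiv ℝ r w + t • fderiv ℝ (z ∘ r) w := by
    rw [deform_comp, fderiv_add hr (hz.const_smul t), fderiv_const_smul hz]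
  rw [partialU, partialV, this]
  exact ⟨rfl, rfl⟩

/-- To first order in `t` the deformation is isometric, and to second order the lengths of tangent
vectors do not decrease; hence it is immersive for every `t`. -/
lemma IsInfinitesimalBending.linearIndependent_deform (hz : IsInfinitesimalBending S z)
    (h : IsLocalParam S U r) {w : ℝ × ℝ} (hw : w ∈ U) (t : ℝ) :
    LinearIndependent ℝ ![partialU (deform z t ∘ r) w, partialV (deform z t ∘ r) w] := by
  have hzd := ((hz.smooth U r h).contDiffAt (h.isOpen.mem_nhds hw)).differentiableAt (by simp)
  obtain ⟨e1, e2⟩ := partial_deform ((h.contDiffAt hw).differentiableAt (by simp)) hzd t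
  obtain ⟨b1, b2, b3⟩ := hz.bending U r h w hw
  rw [e1, e2, LinearIndependent.pair_iff]
  intro x y hxy
  refine LinearIndependent.pair_iff.1 (h.linearIndependent w hw) x y ?_
  set a := partialU r w
  set b := partialV r w
  set a' := partialU (z ∘ r) w
  set b' := partialV (z ∘ r) w
  have hsum : (x • a + y • b) + t • (x • a' + y • b') = 0 := by rw [← hxy]; module
  have horth : inner ℝ (x • a + y • b) (x • a' + y • b') = 0 := by
    simp only [inner_add_left, inner_add_right, inner_smul_left, inner_smul_right,
      RCLike.conj_to_real]
    linear_combination x ^ 2 * b1 + x * y * b2 + y ^ 2 * b3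
  have := congrArg (fun v => inner ℝ (x • a + y • b) v) hsum
  simp only [inner_add_right _ (x • a + y • b) (t • _), inner_smul_right _ (x • a' + y • b') t,
    horth, mul_zero, add_zero, inner_zero_right] at this
  exact inner_self_eq_zero.1 this

/-- An infinitesimal bending deforms a compact surface through embedded surfaces. They stay
injective because the bending field is Lipschitz. -/
lemma eventually_isSurfaceEmbedding_deform (hS : IsSmoothSurface S) (hSc : IsCompact S)
    (hz : IsInfinitesimalBending S z) : ∀ᶠ t in 𝓝 (0 : ℝ), IsSurfaceEmbedding S (deform z t) := by
  obtain ⟨K, hK⟩ := exists_lipschitzOnWith_of_smooth hS hSc hz.smooth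
  have ht : ∀ᶠ t in 𝓝 (0 : ℝ), |t| * (K : ℝ) < 1 := by
    have : ContinuousAt (fun t : ℝ => |t| * K) 0 := by fun_prop
    exact this.eventually (Iio_mem_nhds (by simp))
  filter_upwards [ht] with t ht
  refine ⟨fun U r h => ?_, fun U r h w hw => hz.linearIndependent_deform h hw t,
    fun p hp q hq e => ?_⟩
  · rw [deform_comp]
    exact h.contDiffOn.add (contDiffOn_const.smul (hz.smooth U r h))
  · have h1 : p - q = t • (z q - z p) := by
      have : p + t • z p = q + t • z q := e
      rw [smul_sub, sub_eq_sub_iff_add_eq_add, this, add_comm]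
    have h2 : ‖p - q‖ ≤ |t| * K * ‖p - q‖ := by
      have := hK.norm_sub_le hq hp
      calc ‖p - q‖ = |t| * ‖z q - z p‖ := by rw [h1, norm_smul, Real.norm_eq_abs]
        _ ≤ |t| * (K * ‖q - p‖) := by gcongr
        _ = |t| * K * ‖p - q‖ := by rw [norm_sub_rev]; ring
    by_contra hne
    have h3 : 0 < ‖p - q‖ := norm_pos_iff.2 (sub_ne_zero.2 hne)
    nlinarith

end

section

/-! ### Integrals with compact support in an open set -/

section Calculus

variable {U K : Set (ℝ × ℝ)}

lemma integrableOn_of_compact_support {f : ℝ × ℝ → ℝ} (hU : IsOpen U) (hK : IsCompact K)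
    (hKU : K ⊆ U) (hf : ContinuousOn f U) (hsupp : ∀ w ∈ U \ K, f w = 0) : IntegrableOn f U :=
  ((hf.mono hKU).integrableOn_compact hK).of_forall_sdiff_eq_zero hU.measurableSet hsupp

lemma integral_fderiv_eq_zero_of_compact_support {f : ℝ × ℝ → ℝ} (hU : IsOpen U)
    (hK : IsCompact K) (hKU : K ⊆ U) (hf : ContDiffOn ℝ ∞ f U) (hsupp : ∀ w ∈ U \ K, f w = 0)
    (v : ℝ × ℝ) : ∫ w in U, fderiv ℝ f w v = 0 := by
  set g := U.indicator f with hg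
  have hgU {w : ℝ × ℝ} (hw : w ∈ U) : g =ᶠ[𝓝 w] f := by
    filter_upwards [hU.mem_nhds hw] with x hx using indicator_of_mem hx f
  have hgK {w : ℝ × ℝ} (hw : w ∉ K) : g =ᶠ[𝓝 w] fun _ => 0 := by
    filter_upwards [hK.isClosed.isOpen_compl.mem_nhds hw] with x hx
    by_cases hxU : x ∈ U
    · rw [hg, indicator_of_mem hxU, hsupp x ⟨hxU, hx⟩]
    · exact indicator_of_notMem hxU f
  have hgC : ContDiff ℝ ∞ g := by
    rw [contDiff_iff_contDiffAt]
    intro w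
    by_cases hw : w ∈ U
    · exact (hf.contDiffAt (hU.mem_nhds hw)).congr_of_eventuallyEq (hgU hw)
    · exact contDiffAt_const.congr_of_eventuallyEq (hgK fun h => hw (hKU h))
  have hgs : HasCompactSupport g :=
    HasCompactSupport.intro hK fun w hw => (hgK hw).self_of_nhds
  have hd : Differentiable ℝ g := hgC.differentiable (by simp)
  have hcont : Continuous fun w => fderiv ℝ g w v :=
    (hgC.continuous_fderiv (by simp)).clm_apply continuous_const
  have hcs : HasCompactSupport fun w => fderiv ℝ g w v := hgs.fderiv_apply ℝ v
  have h0 : ∫ w, fderiv ℝ g w v = 0 := by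
    have := integral_mul_fderiv_eq_neg_fderiv_mul_of_integrable (μ := volume) (v := v)
      (f := fun _ : ℝ × ℝ => (1 : ℝ)) (g := g) (by simp)
      (by simpa using hcont.integrable_of_hasCompactSupport hcs)
      (by simpa using hgC.continuous.integrable_of_hasCompactSupport hgs)
      (fun _ _ => differentiableAt_const _) (fun w _ => hd w)
    simpa using this
  have hout : ∀ w ∉ U, fderiv ℝ g w v = 0 := fun w hw => by
    rw [(hgK fun h => hw (hKU h)).fderiv_eq]; simp
  rw [← h0, ← setIntegral_eq_integral_of_forall_compl_eq_zero hout]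
  refine setIntegral_congr_fun hU.measurableSet fun w hw => ?_
  simp only [(hgU hw).fderiv_eq]

/-- Differentiation under the integral sign of a smooth function along line segments. -/
lemma hasDerivAt_integral_comp_line {E : Type*} [NormedAddCommGroup E] [NormedSpace ℝ E]
    {D : E → ℝ} {O : Set E} (hO : IsOpen O) (hD : ContDiffOn ℝ ∞ D O) (hK : IsCompact K)
    {c : ℝ × ℝ → ℝ} {j j' : ℝ × ℝ → E} (hc : ContinuousOn c K) (hj : ContinuousOn j K)
    (hj' : ContinuousOn j' K) (hjO : ∀ w ∈ K, ∀ t : ℝ, j w + t • j' w ∈ O) :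
    HasDerivAt (fun t : ℝ => ∫ w in K, c w * D (j w + t • j' w))
      (∫ w in K, c w * fderiv ℝ D (j w) (j' w)) 0 := by
  set F' : ℝ → ℝ × ℝ → ℝ := fun t w => c w * fderiv ℝ D (j w + t • j' w) (j' w) with hF'
  have hfd : ContinuousOn (fderiv ℝ D) O := hD.continuousOn_fderiv_of_isOpen hO (by simp)
  have hline : ContinuousOn (fun p : ℝ × (ℝ × ℝ) => j p.2 + p.1 • j' p.2) (Icc (-1) 1 ×ˢ K) :=
    (hj.comp continuousOn_snd fun p hp => hp.2).add
      (continuousOn_fst.smul (hj'.comp continuousOn_snd fun p hp => hp.2))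
  have hF'c : ContinuousOn (fun p : ℝ × (ℝ × ℝ) => F' p.1 p.2) (Icc (-1) 1 ×ˢ K) :=
    (hc.comp continuousOn_snd fun p hp => hp.2).mul
      ((hfd.comp hline fun p hp => hjO _ hp.2 _).clm_apply
        (hj'.comp continuousOn_snd fun p hp => hp.2))
  obtain ⟨C, hC⟩ := (isCompact_Icc.prod hK).exists_bound_of_continuousOn hF'c
  have hFc (t : ℝ) : ContinuousOn (fun w => c w * D (j w + t • j' w)) K :=
    hc.mul (hD.continuousOn.comp (hj.add (hj'.const_smul t)) fun w hw => hjO w hw t)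
  have hF'0 : F' 0 = fun w => c w * fderiv ℝ D (j w) (j' w) := by
    funext w; simp only [hF', zero_smul, add_zero]
  have hF'0c : ContinuousOn (F' 0) K :=
    hF'c.comp (f := fun w => ((0 : ℝ), w)) (by fun_prop) fun w hw => ⟨by simp, hw⟩
  have := (hasDerivAt_integral_of_dominated_loc_of_deriv_le (μ := volume.restrict K)
    (F := fun t w => c w * D (j w + t • j' w)) (F' := F') (x₀ := (0 : ℝ)) (s := Icc (-1) 1)
    (bound := fun _ => C) (Icc_mem_nhds (by norm_num) (by norm_num))
    (Eventually.of_forall fun t => (hFc t).aestronglyMeasurable hK.measurableSet)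
    ((hFc 0).integrableOn_compact hK) (hF'0c.aestronglyMeasurable hK.measurableSet) ?_ ?_ ?_).2
  · rwa [hF'0] at this
  · filter_upwards [ae_restrict_mem hK.measurableSet] with w hw t ht using hC (t, w) ⟨ht, hw⟩
  · exact integrableOn_const hK.measure_lt_top.ne
  · filter_upwards [ae_restrict_mem hK.measurableSet] with w hw t ht
    have h1 : HasFDerivAt D (fderiv ℝ D (j w + t • j' w)) (j w + t • j' w) :=
      ((hD.contDiffAt (hO.mem_nhds (hjO w hw t))).differentiableAt (by simp)).hasFDerivAt
    have h2 : HasDerivAt (fun t : ℝ => j w + t • j' w) (j' w) t := by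
      simpa using ((hasDerivAt_id t).smul_const (j' w)).const_add (j w)
    exact (h1.comp_hasDerivAt t h2).const_mul (c w)

end Calculus

/-! ### Partitions of unity on a compact surface -/

variable {S : Set Space3} {U : Set (ℝ × ℝ)} {r : ℝ × ℝ → Space3} {N z : Space3 → Space3}

/-- A smooth partition of unity subordinate to a finite atlas. The sum is `1` in a neighbourhood of
the surface, so that the gradients in `ℝ³` add up to `0` on the surface. -/
lemma exists_partition {n : ℕ} {U : Fin n → Set (ℝ × ℝ)} {r : Fin n → ℝ × ℝ → Space3}
    (hSc : IsCompact S) (h : ∀ i, IsLocalParam S (U i) (r i)) (hcov : S ⊆ ⋃ i, r i '' U i) :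
    ∃ ρ : Fin n → Space3 → ℝ, (∀ i, ContDiff ℝ ∞ (ρ i)) ∧
      (∀ i, S ∩ tsupport (ρ i) ⊆ r i '' U i) ∧ ∀ p ∈ S, ∀ᶠ q in 𝓝 p, ∑ i, ρ i q = 1 := by
  have hO (i : Fin n) : ∃ O : Set Space3, IsOpen O ∧ r i '' U i ⊆ O ∧ S ∩ O ⊆ r i '' U i := by
    obtain ⟨O, hO, e⟩ := isOpen_induced_iff.1 (h i).isOpenEmbedding.isOpen_range
    refine ⟨O, hO, ?_, ?_⟩
    · rintro _ ⟨w, hw, rfl⟩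
      have : (h i).mapsTo.restrict (r i) (U i) S ⟨w, hw⟩ ∈ Subtype.val ⁻¹' O :=
        e ▸ mem_range_self _
      exact this
    · rintro p ⟨hp, hpO⟩
      have : (⟨p, hp⟩ : S) ∈ Subtype.val ⁻¹' O := hpO
      rw [e] at this
      obtain ⟨w, hw⟩ := this
      exact ⟨w, w.2, congrArg Subtype.val hw⟩
  choose O hOo hrO hSO using hO
  have hSO' : S ⊆ ⋃ i, O i := hcov.trans (iUnion_mono hrO)
  obtain ⟨L, hL, hSL, hLO⟩ := exists_compact_between hSc (isOpen_iUnion hOo) hSO'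
  obtain ⟨ρ, hρ⟩ := SmoothPartitionOfUnity.exists_isSubordinate (modelWithCornersSelf ℝ Space3)
    hL.isClosed O hOo hLO
  refine ⟨fun i => ρ i, fun i => (ρ i).contMDiff.contDiff, fun i => ?_, fun p hp => ?_⟩
  · exact (inter_subset_inter_right _ (hρ i)).trans (hSO i)
  · filter_upwards [isOpen_interior.mem_nhds (hSL hp)] with q hq
    rw [← finsum_eq_sum_of_fintype]
    exact ρ.sum_eq_one (interior_subset hq)

lemma IsLocalParam.isCompact_preimage (h : IsLocalParam S U r) (hSc : IsCompact S)
    {C : Set Space3} (hC : IsClosed C) (hsub : S ∩ C ⊆ r '' U) : IsCompact (U ∩ r ⁻¹' C) := by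
  have : CompactSpace S := isCompact_iff_compactSpace.1 hSc
  have hCS : IsCompact (Subtype.val ⁻¹' C : Set S) := (hC.preimage continuous_subtype_val).isCompact
  have hpre : IsCompact (h.mapsTo.restrict r U S ⁻¹' (Subtype.val ⁻¹' C)) := by
    refine (h.isOpenEmbedding.isInducing.isCompact_preimage_iff ?_).2 hCS
    rintro ⟨p, hp⟩ hpC
    obtain ⟨w, hw, e⟩ := hsub ⟨hp, hpC⟩
    exact ⟨⟨w, hw⟩, Subtype.ext e⟩
  have e : U ∩ r ⁻¹' C = Subtype.val '' (h.mapsTo.restrict r U S ⁻¹' (Subtype.val ⁻¹' C)) := by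
    ext w; constructor
    · exact fun hw => ⟨⟨w, hw.1⟩, hw.2, rfl⟩
    · rintro ⟨x, hx, rfl⟩; exact ⟨x.2, hx⟩
  rw [e]
  exact hpre.image continuous_subtype_val

end

section

variable {S : Set Space3} {U : Set (ℝ × ℝ)} {r : ℝ × ℝ → Space3} {N z : Space3 → Space3}

/-! ### The rotation field of an infinitesimal bending -/

lemma contDiffAt_cross {f g : ℝ × ℝ → Space3} {w : ℝ × ℝ} (hf : ContDiffAt ℝ ∞ f w)
    (hg : ContDiffAt ℝ ∞ g w) : ContDiffAt ℝ ∞ (fun x => cross (f x) (g x)) w :=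
  contDiff_cross.contDiffAt.comp w (hf.prodMk hg)

lemma partial_cross {f g : ℝ × ℝ → Space3} {w : ℝ × ℝ} (hf : DifferentiableAt ℝ f w)
    (hg : DifferentiableAt ℝ g w) :
    partialU (fun x => cross (f x) (g x)) w =
        cross (partialU f w) (g w) + cross (f w) (partialU g w) ∧
      partialV (fun x => cross (f x) (g x)) w =
        cross (partialV f w) (g w) + cross (f w) (partialV g w) := by
  have h : HasFDerivAt (fun x => cross (f x) (g x)) _ w :=
    HasFDerivAt.comp (g := fun p : Space3 × Space3 => cross p.1 p.2) (f := fun x => (f x, g x)) w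
      (isBoundedBilinearMap_cross.hasFDerivAt (f w, g w)) (hf.hasFDerivAt.prodMk hg.hasFDerivAt)
  rw [partialU, partialV, h.fderiv]
  constructor <;> exact add_comm _ _

/-- The rotation field `y` of the bending `z` in the local parameters `r`, characterised by
`z_u = y × r_u` and `z_v = y × r_v`. -/
noncomputable def rotationAlong (z : Space3 → Space3) (r : ℝ × ℝ → Space3) (w : ℝ × ℝ) : Space3 :=
  rotationVector (partialU r w) (partialV r w) (partialU (z ∘ r) w) (partialV (z ∘ r) w)

lemma IsInfinitesimalBending.contDiffAt (hz : IsInfinitesimalBending S z) (h : IsLocalParam S U r)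
    {w : ℝ × ℝ} (hw : w ∈ U) : ContDiffAt ℝ ∞ (z ∘ r) w :=
  (hz.smooth U r h).contDiffAt (h.isOpen.mem_nhds hw)

lemma IsInfinitesimalBending.contDiffAt_rotationAlong (hz : IsInfinitesimalBending S z)
    (h : IsLocalParam S U r) {w : ℝ × ℝ} (hw : w ∈ U) :
    ContDiffAt ℝ ∞ (rotationAlong z r) w := by
  have ha := contDiffAt_partialU (h.contDiffAt hw)
  have hb := contDiffAt_partialV (h.contDiffAt hw)
  have ha' := contDiffAt_partialU (hz.contDiffAt h hw)
  have hb' := contDiffAt_partialV (hz.contDiffAt h hw)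
  have hm := contDiffAt_cross ha hb
  exact ((hm.inner ℝ hm).inv (inner_cross_self_pos (h.linearIndependent w hw)).ne').smul
    (((((hb'.inner ℝ hm).smul ha).sub ((ha'.inner ℝ hm).smul hb))).add ((ha'.inner ℝ hb).smul hm))

lemma IsInfinitesimalBending.cross_rotationAlong (hz : IsInfinitesimalBending S z)
    (h : IsLocalParam S U r) {w : ℝ × ℝ} (hw : w ∈ U) :
    cross (rotationAlong z r w) (partialU r w) = partialU (z ∘ r) w ∧
      cross (rotationAlong z r w) (partialV r w) = partialV (z ∘ r) w := by
  obtain ⟨b1, b2, b3⟩ := hz.bending U r h w hw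
  exact cross_rotationVector (h.linearIndependent w hw) b1 b2 b3

/-- The second derivatives of the bending field in terms of the rotation field. -/
lemma IsInfinitesimalBending.snd_deriv (hz : IsInfinitesimalBending S z)
    (h : IsLocalParam S U r) {w : ℝ × ℝ} (hw : w ∈ U) :
    partialU (partialU (z ∘ r)) w = cross (partialU (rotationAlong z r) w) (partialU r w) +
        cross (rotationAlong z r w) (partialU (partialU r) w) ∧
      partialV (partialU (z ∘ r)) w = cross (partialV (rotationAlong z r) w) (partialU r w) +
        cross (rotationAlong z r w) (partialV (partialU r) w) ∧
      partialV (partialV (z ∘ r)) w = cross (partialV (rotationAlong z r) w) (partialV r w) +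
        cross (rotationAlong z r w) (partialV (partialV r) w) ∧
      cross (partialU (rotationAlong z r) w) (partialV r w) =
        cross (partialV (rotationAlong z r) w) (partialU r w) := by
  have hy := (hz.contDiffAt_rotationAlong h hw).differentiableAt (by simp)
  have ha := (contDiffAt_partialU (h.contDiffAt hw)).differentiableAt (by simp)
  have hb := (contDiffAt_partialV (h.contDiffAt hw)).differentiableAt (by simp)
  have e1 : partialU (z ∘ r) =ᶠ[𝓝 w] fun x => cross (rotationAlong z r x) (partialU r x) := by
    filter_upwards [h.isOpen.mem_nhds hw] with x hx using (hz.cross_rotationAlong h hx).1.symm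
  have e2 : partialV (z ∘ r) =ᶠ[𝓝 w] fun x => cross (rotationAlong z r x) (partialV r x) := by
    filter_upwards [h.isOpen.mem_nhds hw] with x hx using (hz.cross_rotationAlong h hx).2.symm
  obtain ⟨p1, p2⟩ := partial_cross hy ha
  obtain ⟨p3, p4⟩ := partial_cross hy hb
  have q1 : partialU (partialU (z ∘ r)) w = _ :=
    (congrArg (fun L : ℝ × ℝ →L[ℝ] Space3 => L (1, 0)) e1.fderiv_eq).trans p1
  have q2 : partialV (partialU (z ∘ r)) w = _ :=
    (congrArg (fun L : ℝ × ℝ →L[ℝ] Space3 => L (0, 1)) e1.fderiv_eq).trans p2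
  have q3 : partialU (partialV (z ∘ r)) w = _ :=
    (congrArg (fun L : ℝ × ℝ →L[ℝ] Space3 => L (1, 0)) e2.fderiv_eq).trans p3
  have q4 : partialV (partialV (z ∘ r)) w = _ :=
    (congrArg (fun L : ℝ × ℝ →L[ℝ] Space3 => L (0, 1)) e2.fderiv_eq).trans p4
  refine ⟨q1, q2, q4, ?_⟩
  rw [partialU_partialV_comm (hz.contDiffAt h hw), q2,
    partialU_partialV_comm (h.contDiffAt hw)] at q3
  exact (add_right_cancel q3).symm

/-- The rotation field does not depend on the parametrization. -/
lemma IsInfinitesimalBending.exists_rotationField (hz : IsInfinitesimalBending S z) :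
    ∃ Y : Space3 → Space3, ∀ U r, IsLocalParam S U r → ∀ w ∈ U,
      Y (r w) = rotationAlong z r w := by
  classical
  have hinv : ∀ U r w U' r' w', IsLocalParam S U r → w ∈ U → IsLocalParam S U' r' → w' ∈ U' →
      r w = r' w' → rotationAlong z r w = rotationAlong z r' w' := by
    intro U r w U' r' w' h hw h' hw' e
    obtain ⟨φ, hφ, rfl, hφe⟩ := h.exists_transition h' hw hw' e
    have hφd := hφ.differentiableAt (by simp)
    have h1 : r =ᶠ[𝓝 w] r' ∘ φ := hφe.mono fun x hx => hx.2
    have h2 : z ∘ r =ᶠ[𝓝 w] (z ∘ r') ∘ φ := h1.mono fun x hx => congrArg z hx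
    obtain ⟨p1, p2⟩ := partial_comp ((h'.contDiffAt hw').differentiableAt (by simp)) hφd h1
    obtain ⟨p3, p4⟩ := partial_comp ((hz.contDiffAt h' hw').differentiableAt (by simp)) hφd h2
    obtain ⟨c1, c2⟩ := hz.cross_rotationAlong h hw
    obtain ⟨c3, c4⟩ := hz.cross_rotationAlong h' hw'
    have hlin (y a b : Space3) (s t : ℝ) :
        cross y (s • a + t • b) = s • cross y a + t • cross y b := by
      apply space3_ext <;>
        simp only [cross_apply_zero, cross_apply_one, cross_apply_two, PiLp.add_apply,
          PiLp.smul_apply, smul_eq_mul] <;> ring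
    refine eq_of_cross_eq (h.linearIndependent w hw) ?_ ?_
    · rw [c1, p1, hlin, c3, c4, p3]
    · rw [c2, p2, hlin, c3, c4, p4]
  refine ⟨fun p => if hp : ∃ x : Set (ℝ × ℝ) × (ℝ × ℝ → Space3) × (ℝ × ℝ),
    IsLocalParam S x.1 x.2.1 ∧ x.2.2 ∈ x.1 ∧ x.2.1 x.2.2 = p then
      rotationAlong z hp.choose.2.1 hp.choose.2.2 else 0, fun U r h w hw => ?_⟩
  have hp : ∃ x : Set (ℝ × ℝ) × (ℝ × ℝ → Space3) × (ℝ × ℝ),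
    IsLocalParam S x.1 x.2.1 ∧ x.2.2 ∈ x.1 ∧ x.2.1 x.2.2 = r w := ⟨(U, r, w), h, hw, rfl⟩
  simp only [dif_pos hp]
  obtain ⟨s1, s2, s3⟩ := hp.choose_spec
  exact hinv _ _ _ _ _ _ s1 s2 h hw s3

/-! ### The variation of the mean curvature density -/

/-- The first and second derivatives `(r_u, r_v, r_uu, r_uv, r_vv)`. -/
noncomputable def jet (r : ℝ × ℝ → Space3) (w : ℝ × ℝ) :
    Space3 × Space3 × Space3 × Space3 × Space3 :=
  (partialU r w, partialV r w, partialU (partialU r) w, partialV (partialU r) w,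
    partialV (partialV r) w)

/-- `meanDensity` as a function on the space of jets. -/
noncomputable def jetDensity (x : Space3 × Space3 × Space3 × Space3 × Space3) : ℝ :=
  meanDensity x.1 x.2.1 x.2.2.1 x.2.2.2.1 x.2.2.2.2

/-- The jets of immersions. -/
def immersiveJets : Set (Space3 × Space3 × Space3 × Space3 × Space3) :=
  {x | cross x.1 x.2.1 ≠ 0}

lemma contDiff_cross_jet : ContDiff ℝ ∞
    (fun x : Space3 × Space3 × Space3 × Space3 × Space3 => cross x.1 x.2.1) :=
  contDiff_cross.comp (contDiff_fst.prodMk (contDiff_fst.comp contDiff_snd))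

lemma isOpen_immersiveJets : IsOpen immersiveJets :=
  isOpen_ne_fun contDiff_cross_jet.continuous continuous_const

lemma contDiffOn_jetDensity : ContDiffOn ℝ ∞ jetDensity immersiveJets := by
  have hm := contDiff_cross_jet
  unfold jetDensity meanDensity meanNum
  refine ContDiffOn.div (ContDiff.contDiffOn ?_) (ContDiff.contDiffOn ?_) fun x hx => ?_
  · have ha : ContDiff ℝ ∞ (fun x : Space3 × Space3 × Space3 × Space3 × Space3 => x.1) := by
      fun_prop
    have hb : ContDiff ℝ ∞ (fun x : Space3 × Space3 × Space3 × Space3 × Space3 => x.2.1) := by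
      fun_prop
    have hc : ContDiff ℝ ∞ (fun x : Space3 × Space3 × Space3 × Space3 × Space3 => x.2.2.1) := by
      fun_prop
    have hd : ContDiff ℝ ∞ (fun x : Space3 × Space3 × Space3 × Space3 × Space3 => x.2.2.2.1) := by
      fun_prop
    have he : ContDiff ℝ ∞ (fun x : Space3 × Space3 × Space3 × Space3 × Space3 => x.2.2.2.2) := by
      fun_prop
    exact (((ha.inner ℝ ha).mul (he.inner ℝ hm)).sub
      ((contDiff_const.mul (ha.inner ℝ hb)).mul (hd.inner ℝ hm))).add
      ((hb.inner ℝ hb).mul (hc.inner ℝ hm))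
  · exact contDiff_const.mul (hm.inner ℝ hm)
  · have : 0 < inner ℝ (cross x.1 x.2.1) (cross x.1 x.2.1) := real_inner_self_pos.2 hx
    positivity

lemma continuousAt_jet {w : ℝ × ℝ} (h : ContDiffAt ℝ ∞ r w) : ContinuousAt (jet r) w := by
  have ha := contDiffAt_partialU h
  have hb := contDiffAt_partialV h
  exact ha.continuousAt.prodMk (hb.continuousAt.prodMk ((contDiffAt_partialU ha).continuousAt.prodMk
    ((contDiffAt_partialV ha).continuousAt.prodMk (contDiffAt_partialV hb).continuousAt)))

lemma IsInfinitesimalBending.jet_deform (hz : IsInfinitesimalBending S z) (h : IsLocalParam S U r)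
    {w : ℝ × ℝ} (hw : w ∈ U) (t : ℝ) :
    jet (deform z t ∘ r) w = jet r w + t • jet (z ∘ r) w := by
  have hp {x : ℝ × ℝ} (hx : x ∈ U) := partial_deform ((h.contDiffAt hx).differentiableAt (by simp))
    ((hz.contDiffAt h hx).differentiableAt (by simp)) t
  have e1 : partialU (deform z t ∘ r) =ᶠ[𝓝 w] partialU r + t • partialU (z ∘ r) := by
    filter_upwards [h.isOpen.mem_nhds hw] with x hx using (hp hx).1
  have e2 : partialV (deform z t ∘ r) =ᶠ[𝓝 w] partialV r + t • partialV (z ∘ r) := by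
    filter_upwards [h.isOpen.mem_nhds hw] with x hx using (hp hx).2
  have d1 := (contDiffAt_partialU (h.contDiffAt hw)).differentiableAt (by simp)
  have d2 := (contDiffAt_partialV (h.contDiffAt hw)).differentiableAt (by simp)
  have d3 := (contDiffAt_partialU (hz.contDiffAt h hw)).differentiableAt (by simp)
  have d4 := (contDiffAt_partialV (hz.contDiffAt h hw)).differentiableAt (by simp)
  have f1 : fderiv ℝ (partialU (deform z t ∘ r)) w =
      fderiv ℝ (partialU r) w + t • fderiv ℝ (partialU (z ∘ r)) w := by
    rw [e1.fderiv_eq, fderiv_add d1 (d3.const_smul t), fderiv_const_smul d3]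
  have f2 : fderiv ℝ (partialV (deform z t ∘ r)) w =
      fderiv ℝ (partialV r) w + t • fderiv ℝ (partialV (z ∘ r)) w := by
    rw [e2.fderiv_eq, fderiv_add d2 (d4.const_smul t), fderiv_const_smul d4]
  refine Prod.ext (hp hw).1 (Prod.ext (hp hw).2 (Prod.ext ?_ (Prod.ext ?_ ?_)))
  · exact congrArg (fun L : ℝ × ℝ →L[ℝ] Space3 => L (1, 0)) f1
  · exact congrArg (fun L : ℝ × ℝ →L[ℝ] Space3 => L (0, 1)) f1
  · exact congrArg (fun L : ℝ × ℝ →L[ℝ] Space3 => L (0, 1)) f2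

lemma IsInfinitesimalBending.jet_mem (hz : IsInfinitesimalBending S z) (h : IsLocalParam S U r)
    {w : ℝ × ℝ} (hw : w ∈ U) (t : ℝ) : jet r w + t • jet (z ∘ r) w ∈ immersiveJets := by
  rw [← hz.jet_deform h hw]
  exact cross_ne_zero (hz.linearIndependent_deform h hw t)

lemma IsInfinitesimalBending.fderiv_jetDensity (hz : IsInfinitesimalBending S z)
    (h : IsLocalParam S U r) {w : ℝ × ℝ} (hw : w ∈ U) :
    fderiv ℝ jetDensity (jet r w) (jet (z ∘ r) w) =
      (inner ℝ (partialV (rotationAlong z r) w) (partialU r w) -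
        inner ℝ (partialU (rotationAlong z r) w) (partialV r w)) / 2 := by
  obtain ⟨s1, s2, s3, s4⟩ := hz.snd_deriv h hw
  obtain ⟨c1, c2⟩ := hz.cross_rotationAlong h hw
  have h0 : jet r w ∈ immersiveJets := cross_ne_zero (h.linearIndependent w hw)
  have h1 : HasFDerivAt jetDensity (fderiv ℝ jetDensity (jet r w))
      (jet r w + (0 : ℝ) • jet (z ∘ r) w) := by
    rw [zero_smul, add_zero]
    exact ((contDiffOn_jetDensity.contDiffAt (isOpen_immersiveJets.mem_nhds h0)).differentiableAt
      (by simp)).hasFDerivAt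
  have h2 : HasDerivAt (fun t : ℝ => jet r w + t • jet (z ∘ r) w) (jet (z ∘ r) w) 0 := by
    simpa using ((hasDerivAt_id (0 : ℝ)).smul_const (jet (z ∘ r) w)).const_add (jet r w)
  refine (h1.comp_hasDerivAt 0 h2).unique ?_
  have h3 := hasDerivAt_meanDensity (c := partialU (partialU r) w)
    (d := partialV (partialU r) w) (e := partialV (partialV r) w) (y := rotationAlong z r w)
    (h.linearIndependent w hw) s4
  rw [c1, c2, ← s1, ← s2, ← s3] at h3
  exact h3

/-- The mean curvature times the area density is the mean curvature density of the jet. -/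
lemma HasNormalSign.meanCurvature_eq {ε : ℝ} (hε : HasNormalSign N ε U r) (h : IsLocalParam S U r)
    {w : ℝ × ℝ} (hw : w ∈ U) :
    ‖cross (partialU r w) (partialV r w)‖ * meanCurvature S N (r w) = ε * jetDensity (jet r w) := by
  have hm := norm_pos_iff.2 (cross_ne_zero (h.linearIndependent w hw))
  have hn := hε.2 w hw
  rw [Surf.meanCurvature_eq h hw (by rw [hn, inner_smul_left, real_inner_comm, inner_cross_left,
      mul_zero]) (by rw [hn, inner_smul_left, real_inner_comm, inner_cross_right, mul_zero]), hn]
  simp only [inner_smul_right, jetDensity, jet, meanDensity, meanNum, real_inner_self_eq_norm_sq]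
  field_simp

end

section

variable {S : Set Space3} {U : Set (ℝ × ℝ)} {r : ℝ × ℝ → Space3} {N ψ z : Space3 → Space3}
  {ρ : Space3 → ℝ}

/-! ### Stokes' theorem for the rotation form -/

/-- Green's theorem for functions with compact support in an open set. -/
lemma integral_curl_eq_zero {K : Set (ℝ × ℝ)} {f g : ℝ × ℝ → ℝ} (hU : IsOpen U)
    (hK : IsCompact K) (hKU : K ⊆ U) (hf : ContDiffOn ℝ ∞ f U) (hg : ContDiffOn ℝ ∞ g U)
    (hf0 : ∀ w ∈ U \ K, f w = 0) (hg0 : ∀ w ∈ U \ K, g w = 0) :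
    IntegrableOn (fun w => fderiv ℝ f w (1, 0) - fderiv ℝ g w (0, 1)) U ∧
      ∫ w in U, (fderiv ℝ f w (1, 0) - fderiv ℝ g w (0, 1)) = 0 := by
  have key {f : ℝ × ℝ → ℝ} (hf : ContDiffOn ℝ ∞ f U) (hf0 : ∀ w ∈ U \ K, f w = 0) (v : ℝ × ℝ) :
      IntegrableOn (fun w => fderiv ℝ f w v) U := by
    refine integrableOn_of_compact_support hU hK hKU
      ((hf.continuousOn_fderiv_of_isOpen hU (by simp)).clm_apply continuousOn_const) fun w hw => ?_
    have : f =ᶠ[𝓝 w] fun _ => 0 := by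
      filter_upwards [(hU.sdiff hK.isClosed).mem_nhds hw] with x hx using hf0 x hx
    rw [this.fderiv_eq]; simp
  refine ⟨(key hf hf0 _).sub (key hg hg0 _), ?_⟩
  rw [integral_sub (key hf hf0 _) (key hg hg0 _),
    integral_fderiv_eq_zero_of_compact_support hU hK hKU hf hf0,
    integral_fderiv_eq_zero_of_compact_support hU hK hKU hg hg0, sub_zero]

lemma eq_zero_of_notMem {w : ℝ × ℝ} (hw : w ∈ U \ (U ∩ r ⁻¹' tsupport ρ)) :
    ρ (r w) = 0 :=
  image_eq_zero_of_notMem_tsupport fun hρ => hw.2 ⟨hw.1, hρ⟩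

/-- Integration by parts for the form `y · dr`, whose differential is the variation of the mean
curvature density, against a cutoff function `ρ`. -/
lemma IsInfinitesimalBending.integral_by_parts (hz : IsInfinitesimalBending S z)
    (h : IsLocalParam S U r) (hSc : IsCompact S) (hρ : ContDiff ℝ ∞ ρ)
    (hsub : S ∩ tsupport ρ ⊆ r '' U) :
    IntegrableOn (fun w => inner ℝ (cross (gradient ρ (r w)) (rotationAlong z r w))
      (cross (partialU r w) (partialV r w))) U ∧
    ∫ w in U, inner ℝ (cross (gradient ρ (r w)) (rotationAlong z r w))
      (cross (partialU r w) (partialV r w)) =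
    ∫ w in U, ρ (r w) * (inner ℝ (partialV (rotationAlong z r) w) (partialU r w) -
      inner ℝ (partialU (rotationAlong z r) w) (partialV r w)) := by
  have hK := h.isCompact_preimage hSc (isClosed_tsupport ρ) hsub
  have hKU : U ∩ r ⁻¹' tsupport ρ ⊆ U := inter_subset_left
  set y := rotationAlong z r with hydef
  have hρr {w : ℝ × ℝ} (hw : w ∈ U) : ContDiffAt ℝ ∞ (fun x => ρ (r x)) w :=
    hρ.contDiffAt.comp w (h.contDiffAt hw)
  have hy {w : ℝ × ℝ} (hw : w ∈ U) := hz.contDiffAt_rotationAlong h hw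
  have ha {w : ℝ × ℝ} (hw : w ∈ U) := contDiffAt_partialU (h.contDiffAt hw)
  have hb {w : ℝ × ℝ} (hw : w ∈ U) := contDiffAt_partialV (h.contDiffAt hw)
  set f : ℝ × ℝ → ℝ := fun w => ρ (r w) * inner ℝ (y w) (partialV r w) with hf
  set g : ℝ × ℝ → ℝ := fun w => ρ (r w) * inner ℝ (y w) (partialU r w) with hg
  have hfC : ContDiffOn ℝ ∞ f U := fun w hw =>
    ((hρr hw).mul ((hy hw).inner ℝ (hb hw))).contDiffWithinAt
  have hgC : ContDiffOn ℝ ∞ g U := fun w hw =>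
    ((hρr hw).mul ((hy hw).inner ℝ (ha hw))).contDiffWithinAt
  obtain ⟨hint, h0⟩ := integral_curl_eq_zero h.isOpen hK hKU hfC hgC
    (fun w hw => by simp only [hf, eq_zero_of_notMem hw, zero_mul])
    (fun w hw => by simp only [hg, eq_zero_of_notMem hw, zero_mul])
  have hBint : IntegrableOn (fun w => ρ (r w) * (inner ℝ (partialV y w) (partialU r w) -
      inner ℝ (partialU y w) (partialV r w))) U := by
    refine integrableOn_of_compact_support h.isOpen hK hKU (fun w hw => ?_) fun w hw => ?_
    · exact ((hρr hw).continuousAt.mul (((contDiffAt_partialV (hy hw)).continuousAt.inner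
        (ha hw).continuousAt).sub ((contDiffAt_partialU (hy hw)).continuousAt.inner
        (hb hw).continuousAt))).continuousWithinAt
    · rw [eq_zero_of_notMem hw, zero_mul]
  have hpt : ∀ w ∈ U, inner ℝ (cross (gradient ρ (r w)) (y w))
      (cross (partialU r w) (partialV r w)) =
      (fderiv ℝ f w (1, 0) - fderiv ℝ g w (0, 1)) + ρ (r w) *
        (inner ℝ (partialV y w) (partialU r w) - inner ℝ (partialU y w) (partialV r w)) := by
    intro w hw
    have dρ : HasFDerivAt (fun x => ρ (r x)) _ w :=
      ((hρ.differentiable (by simp)).differentiableAt.hasFDerivAt).comp w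
        ((h.contDiffAt hw).differentiableAt (by simp)).hasFDerivAt
    have dy := ((hy hw).differentiableAt (by simp)).hasFDerivAt
    have da := ((ha hw).differentiableAt (by simp)).hasFDerivAt
    have db := ((hb hw).differentiableAt (by simp)).hasFDerivAt
    have df : HasFDerivAt f _ w := dρ.mul (dy.inner ℝ db)
    have dg : HasFDerivAt g _ w := dρ.mul (dy.inner ℝ da)
    have hmix := partialU_partialV_comm (h.contDiffAt hw)
    have hgrad (v : Space3) : fderiv ℝ ρ (r w) v = inner ℝ (gradient ρ (r w)) v := by
      rw [inner_gradient_left]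
    rw [df.fderiv, dg.fderiv, inner_cross_cross]
    simp only [_root_.add_apply, _root_.smul_apply, ContinuousLinearMap.comp_apply, smul_eq_mul,
      hgrad, fderivInnerCLM_apply, ContinuousLinearMap.prod_apply]
    change _ = ρ (r w) * (inner ℝ (y w) (partialU (partialV r) w) +
        inner ℝ (partialU y w) (partialV r w)) +
        inner ℝ (y w) (partialV r w) * inner ℝ (gradient ρ (r w)) (partialU r w) -
      (ρ (r w) * (inner ℝ (y w) (partialV (partialU r) w) +
        inner ℝ (partialV y w) (partialU r w)) +
        inner ℝ (y w) (partialU r w) * inner ℝ (gradient ρ (r w)) (partialV r w)) + _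
    rw [hmix]
    ring
  have hU := h.isOpen.measurableSet
  refine ⟨(hint.add hBint).congr_fun (fun w hw => (hpt w hw).symm) hU, ?_⟩
  rw [setIntegral_congr_fun hU hpt, integral_add hint hBint, h0, zero_add]

/-- Stokes' theorem: the integrals of the differentials of `ρ i (y · dr)` over a closed surface add
up to the integral of the differential of `∑ i, ρ i`, which vanishes. -/
lemma IsInfinitesimalBending.sum_integral_eq_zero (hS : IsSmoothSurface S) (hSc : IsCompact S)
    (hz : IsInfinitesimalBending S z) {n : ℕ} {U : Fin n → Set (ℝ × ℝ)}
    {r : Fin n → ℝ × ℝ → Space3} {ε : Fin n → ℝ} {ρ : Fin n → Space3 → ℝ}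
    (h : ∀ i, IsLocalParam S (U i) (r i)) (hε : ∀ i, HasNormalSign N (ε i) (U i) (r i))
    (hρ : ∀ i, ContDiff ℝ ∞ (ρ i)) (hsub : ∀ i, S ∩ tsupport (ρ i) ⊆ r i '' U i)
    (hsum : ∀ p ∈ S, ∀ᶠ q in 𝓝 p, ∑ i, ρ i q = 1) :
    ∑ i, ε i * ∫ w in U i, inner ℝ (cross (gradient (ρ i) (r i w)) (rotationAlong z (r i) w))
      (cross (partialU (r i) w) (partialV (r i) w)) = 0 := by
  classical
  obtain ⟨Y, hY⟩ := hz.exists_rotationField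
  set k : Fin n → Space3 → ℝ := fun i p =>
    if p ∈ S then inner ℝ (cross (gradient (ρ i) p) (Y p)) (N p) else 0 with hk
  have hksupp (i : Fin n) : ∀ p ∉ r i '' U i, k i p = 0 := by
    intro p hp
    by_cases hpS : p ∈ S
    · have hpt : p ∉ tsupport (ρ i) := fun ht => hp (hsub i ⟨hpS, ht⟩)
      have : gradient (ρ i) p = 0 := by
        have e : ρ i =ᶠ[𝓝 p] fun _ => 0 := notMem_tsupport_iff_eventuallyEq.1 hpt
        rw [gradient, e.fderiv_eq]; simp
      have h0 : cross 0 (Y p) = 0 := by simpa using cross_linear_comb 0 (Y p) 0 0 0 1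
      simp only [hk, if_pos hpS, this, h0, inner_zero_left]
    · simp only [hk, if_neg hpS]
  have hkr (i : Fin n) : ∀ w ∈ U i,
      ‖cross (partialU (r i) w) (partialV (r i) w)‖ * k i (r i w) =
        ε i * inner ℝ (cross (gradient (ρ i) (r i w)) (rotationAlong z (r i) w))
          (cross (partialU (r i) w) (partialV (r i) w)) := by
    intro w hw
    have hm := norm_pos_iff.2 (cross_ne_zero ((h i).linearIndependent w hw))
    simp only [hk, if_pos ((h i).mapsTo hw), (hε i).2 w hw, hY _ _ (h i) w hw, inner_smul_right]
    field_simp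
  have hUm (i : Fin n) := (h i).isOpen.measurableSet
  have hint (i : Fin n) : Integrable (k i) (areaMeasure S) := by
    refine integrable_areaMeasure_of_support hS hSc (h i) (hksupp i) ?_
    refine IntegrableOn.congr_fun ?_ (fun w hw => (hkr i w hw).symm) (hUm i)
    exact (hz.integral_by_parts (h i) hSc (hρ i) (hsub i)).1.const_mul _
  have e (i : Fin n) : ε i * ∫ w in U i, inner ℝ
      (cross (gradient (ρ i) (r i w)) (rotationAlong z (r i) w))
      (cross (partialU (r i) w) (partialV (r i) w)) = ∫ p, k i p ∂(areaMeasure S) := by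
    rw [integral_areaMeasure_of_support hS hSc (h i) (hksupp i),
      setIntegral_congr_fun (hUm i) (hkr i), integral_const_mul]
  simp only [e]
  rw [← integral_finsetSum _ fun i _ => hint i]
  have hzero (p : Space3) : ∑ i, k i p = 0 := by
    by_cases hpS : p ∈ S
    · have hgrad : ∑ i, gradient (ρ i) p = 0 := by
        have hd : ∀ i ∈ Finset.univ, DifferentiableAt ℝ (ρ i) p := fun i _ =>
          ((hρ i).differentiable (by simp)).differentiableAt
        have hs : HasFDerivAt (fun q => ∑ i, ρ i q) (∑ i, fderiv ℝ (ρ i) p) p :=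
          HasFDerivAt.fun_sum fun i hi => (hd i hi).hasFDerivAt
        have e1 : (fun q => ∑ i, ρ i q) =ᶠ[𝓝 p] fun _ => 1 := hsum p hpS
        have e0 : ∑ i, fderiv ℝ (ρ i) p = 0 := by
          rw [← hs.fderiv, e1.fderiv_eq]; simp
        simp only [gradient, ← map_sum, e0, map_zero]
      have hlin : ∑ i, k i p = inner ℝ (cross (∑ i, gradient (ρ i) p) (Y p)) (N p) := by
        have hc : cross (∑ i, gradient (ρ i) p) (Y p) = ∑ i, cross (gradient (ρ i) p) (Y p) :=
          map_sum ((isBoundedBilinearMap_cross.toContinuousLinearMap).flip (Y p))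
            (fun i => gradient (ρ i) p) Finset.univ
        simp only [hk, if_pos hpS, hc, sum_inner]
      have h0 : cross 0 (Y p) = 0 := by simpa using cross_linear_comb 0 (Y p) 0 0 0 1
      rw [hlin, hgrad, h0, inner_zero_left]
    · simp only [hk, if_neg hpS, Finset.sum_const_zero]
  simp only [hzero, integral_zero]

/-! ### The total mean curvature of a deformed surface -/

lemma continuousOn_jetDensity (h : IsLocalParam S U r) :
    ContinuousOn (fun w => jetDensity (jet r w)) U := by
  refine contDiffOn_jetDensity.continuousOn.comp
    (fun w hw => (continuousAt_jet (h.contDiffAt hw)).continuousWithinAt) fun w hw => ?_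
  exact cross_ne_zero (h.linearIndependent w hw)

/-- The total mean curvature of an embedded image of `S`, in terms of a finite atlas and a partition
of unity of `S`. -/
lemma IsSurfaceEmbedding.totalMeanCurvature_eq (hψ : IsSurfaceEmbedding S ψ)
    (hS : IsSmoothSurface S) (hSc : IsCompact S) {n : ℕ} {U : Fin n → Set (ℝ × ℝ)}
    {r : Fin n → ℝ × ℝ → Space3} {ε : Fin n → ℝ} {ρ : Fin n → Space3 → ℝ}
    (h : ∀ i, IsLocalParam S (U i) (r i)) (hε : ∀ i, HasNormalSign N (ε i) (U i) (r i))
    (hρ : ∀ i, ContDiff ℝ ∞ (ρ i)) (hsub : ∀ i, S ∩ tsupport (ρ i) ⊆ r i '' U i)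
    (hsum : ∀ p ∈ S, ∑ i, ρ i p = 1) :
    Integrable (meanCurvature (ψ '' S) (inducedNormal S N ψ)) (areaMeasure (ψ '' S)) ∧
    totalMeanCurvature (ψ '' S) (inducedNormal S N ψ) =
      ∑ i, ε i * ∫ w in U i, ρ i (r i w) * jetDensity (jet (ψ ∘ r i) w) := by
  classical
  have hR (i : Fin n) := hψ.isLocalParam hS hSc (h i)
  -- the partition of unity is transported to `ψ '' S`
  set l : Fin n → Space3 → ℝ := fun i q =>
    if q ∈ ψ '' S then ρ i (Function.invFunOn ψ S q) else 0 with hl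
  have hlψ (i : Fin n) : ∀ p ∈ S, l i (ψ p) = ρ i p := by
    intro p hp
    simp only [hl, if_pos (mem_image_of_mem ψ hp), hψ.injOn.leftInvOn_invFunOn hp]
  have hlsupp (i : Fin n) : ∀ q ∉ (ψ ∘ r i) '' U i, l i q = 0 := by
    intro q hq
    by_cases hqS : q ∈ ψ '' S
    · obtain ⟨p, hp, rfl⟩ := hqS
      rw [hlψ i p hp]
      refine image_eq_zero_of_notMem_tsupport fun ht => hq ?_
      obtain ⟨w, hw, rfl⟩ := hsub i ⟨hp, ht⟩
      exact ⟨w, hw, rfl⟩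
    · simp only [hl, if_neg hqS]
  have hpt (i : Fin n) : ∀ w ∈ U i,
      ‖cross (partialU (ψ ∘ r i) w) (partialV (ψ ∘ r i) w)‖ *
        (l i ((ψ ∘ r i) w) * meanCurvature (ψ '' S) (inducedNormal S N ψ) ((ψ ∘ r i) w)) =
      ε i * (ρ i (r i w) * jetDensity (jet (ψ ∘ r i) w)) := by
    intro w hw
    rw [mul_left_comm, (hψ.inducedNormal_eq (h i) (hε i)).meanCurvature_eq (hR i) hw,
      Function.comp_apply, hlψ i _ ((h i).mapsTo hw)]
    ring
  have hUm (i : Fin n) := (h i).isOpen.measurableSet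
  have hint (i : Fin n) : IntegrableOn (fun w =>
      ‖cross (partialU (ψ ∘ r i) w) (partialV (ψ ∘ r i) w)‖ *
        (l i ((ψ ∘ r i) w) * meanCurvature (ψ '' S) (inducedNormal S N ψ) ((ψ ∘ r i) w)))
      (U i) := by
    refine IntegrableOn.congr_fun ?_ (fun w hw => (hpt i w hw).symm) (hUm i)
    refine Integrable.const_mul ?_ _
    refine integrableOn_of_compact_support (h i).isOpen
      ((h i).isCompact_preimage hSc (isClosed_tsupport (ρ i)) (hsub i)) inter_subset_left
      (((hρ i).continuous.comp_continuousOn (h i).continuousOn).mul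
        (continuousOn_jetDensity (hR i))) fun w hw => ?_
    rw [eq_zero_of_notMem hw, zero_mul]
  obtain ⟨h1, h2⟩ := integral_areaMeasure_eq_sum (hψ.isSmoothSurface hS hSc)
    (hψ.isCompact hS hSc) (l := l) hR (by
      rintro _ ⟨p, hp, rfl⟩
      rw [← hsum p hp]
      exact Finset.sum_congr rfl fun i _ => hlψ i p hp) hlsupp hint
  refine ⟨h1, ?_⟩
  rw [totalMeanCurvature, h2]
  refine Finset.sum_congr rfl fun i _ => ?_
  rw [setIntegral_congr_fun (hUm i) (hpt i), integral_const_mul]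

/-- The variation of the total mean curvature weighted by a cutoff function `ρ` supported in a
chart. -/
lemma IsInfinitesimalBending.hasDerivAt_integral (hz : IsInfinitesimalBending S z)
    (h : IsLocalParam S U r) (hSc : IsCompact S) (hρ : ContDiff ℝ ∞ ρ)
    (hsub : S ∩ tsupport ρ ⊆ r '' U) :
    HasDerivAt (fun t : ℝ => ∫ w in U, ρ (r w) * jetDensity (jet (deform z t ∘ r) w))
      ((∫ w in U, inner ℝ (cross (gradient ρ (r w)) (rotationAlong z r w))
        (cross (partialU r w) (partialV r w))) / 2) 0 := by
  have hK := h.isCompact_preimage hSc (isClosed_tsupport ρ) hsub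
  have hKU : U ∩ r ⁻¹' tsupport ρ ⊆ U := inter_subset_left
  have hU := h.isOpen.measurableSet
  have hKint {F : ℝ × ℝ → ℝ} : ∫ w in U, ρ (r w) * F w =
      ∫ w in U ∩ r ⁻¹' tsupport ρ, ρ (r w) * F w :=
    setIntegral_eq_of_subset_of_forall_sdiff_eq_zero hU hKU fun w hw => by
      rw [eq_zero_of_notMem hw, zero_mul]
  have key := hasDerivAt_integral_comp_line isOpen_immersiveJets contDiffOn_jetDensity hK
    (c := fun w => ρ (r w)) (j := jet r) (j' := jet (z ∘ r))
    (hρ.continuous.comp_continuousOn (h.continuousOn.mono hKU))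
    (fun w hw => (continuousAt_jet (h.contDiffAt (hKU hw))).continuousWithinAt)
    (fun w hw => (continuousAt_jet (hz.contDiffAt h (hKU hw))).continuousWithinAt)
    fun w hw t => hz.jet_mem h (hKU hw) t
  refine (key.congr_deriv ?_).congr_of_eventuallyEq (Eventually.of_forall fun t => ?_)
  · rw [← hKint, (hz.integral_by_parts h hSc hρ hsub).2, ← integral_div]
    refine setIntegral_congr_fun hU fun w hw => ?_
    simp only [hz.fderiv_jetDensity h hw]
    ring
  · simp only
    rw [← hKint]
    refine setIntegral_congr_fun hU fun w hw => ?_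
    simp only [hz.jet_deform h hw t]

end

end Surf

theorem theorem3 (S : Set Space3) (hS : Surf.IsSmoothSurface S) (hSc : IsCompact S)
    (N : Space3 → Space3) (hN : Surf.IsOrientation S N)
    (z : Space3 → Space3) (hz : Surf.IsInfinitesimalBending S z) :
    (∀ᶠ t in 𝓝 (0 : ℝ),
      Surf.IsSmoothSurface (Surf.deform z t '' S) ∧
      Surf.IsOrientation (Surf.deform z t '' S) (Surf.inducedNormal S N (Surf.deform z t)) ∧
      Integrable
        (Surf.meanCurvature (Surf.deform z t '' S) (Surf.inducedNormal S N (Surf.deform z t)))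
        (Surf.areaMeasure (Surf.deform z t '' S))) ∧
    HasDerivAt
      (fun t : ℝ => Surf.totalMeanCurvature (Surf.deform z t '' S)
        (Surf.inducedNormal S N (Surf.deform z t)))
      0 0 := by
  obtain ⟨n, U, r, h, hsign, hcov⟩ := Surf.exists_finite_cover hSc
    fun p hp => Surf.exists_hasNormalSign hS hN hp
  choose ε hε using hsign
  obtain ⟨ρ, hρ, hsub, hsum⟩ := Surf.exists_partition hSc h hcov
  have hemb := Surf.eventually_isSurfaceEmbedding_deform hS hSc hz
  have htotal {t : ℝ} (ht : Surf.IsSurfaceEmbedding S (Surf.deform z t)) :=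
    ht.totalMeanCurvature_eq hS hSc h hε hρ hsub fun p hp => (hsum p hp).self_of_nhds
  refine ⟨hemb.mono fun t ht => ⟨ht.isSmoothSurface hS hSc, ht.isOrientation hS hSc hN,
    (htotal ht).1⟩, ?_⟩
  have hder : HasDerivAt (fun t : ℝ => ∑ i, ε i * ∫ w in U i, ρ i (r i w) *
      Surf.jetDensity (Surf.jet (Surf.deform z t ∘ r i) w)) _ 0 :=
    HasDerivAt.fun_sum fun i _ =>
      (hz.hasDerivAt_integral (h i) hSc (hρ i) (hsub i)).const_mul (ε i)
  refine (hder.congr_deriv ?_).congr_of_eventuallyEq (hemb.mono fun t ht => (htotal ht).2)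
  simp only [mul_div_assoc']
  rw [← Finset.sum_div, hz.sum_integral_eq_zero hS hSc h hε hρ hsub hsum, zero_div]
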